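/- Let $\omega_1,\omega_2\in\mathbb C$ with $\omega_1\in\mathbb R$, $\omega_1>0$, $\operatorname{Im}\omega_2>0$ and $\omega_1\operatorname{Im}\omega_2=\pi/2$, and let $\Lambda=\omega_1\mathbb Z+\omega_2\mathbb Z$. Let $$\sigma(z)=z\prod_{0\ne\omega\in\Lambda}\Bigl(1-\frac z\omega\Bigr)\exp\Bigl\{\frac z\omega+\frac{z^2}{2\omega^2}\Bigr\},\qquad \zeta(z)=\frac1z+\sum_{0\ne\omega\in\Lambda}\Bigl(\frac1{z-\omega}+\frac1\omega+\frac z{\omega^2}\Bigr)$$ be the Weierstrass sigma and zeta functions of $\Lambda$ (so $\zeta$ is the odd primitive of $-\wp$), and put $$\lambda_1=2\zeta(\tfrac12\omega_1),\qquad b=1-\frac{\lambda_1}{2\omega_1},\qquad \sigma_*(z)=e^{bz^2}\sigma(z).$$ For $\alpha\in\mathbb C$ let $\pi_\alpha(z)=e^{2i\operatorname{Im}(\bar\alpha z)}\,e^{-|z-\alpha|^2}\,\sigma_*(z-\alpha)$. Let $N\ge1$ be an integer, and for $\boldsymbol\alpha=(\alpha_1,\dots,\alpha_N)\in\mathbb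 C^N$ let $\Pi_{\boldsymbol\alpha}=\pi_{\alpha_1}\cdots\pi_{\alpha_N}$. For $\gamma\in\mathbb C$ define the fiber of toroidal pseudopolynomials of degree $N$ over $\gamma$ by $$\psi\mathrm{pol}_N^\gamma(\mathbb C/\Lambda)=\bigl\{\lambda\,\Pi_{\boldsymbol\alpha}:\ \lambda\in\mathbb C,\ \boldsymbol\alpha\in\mathbb C^N,\ \alpha_1+\cdots+\alpha_N-\gamma\in\Lambda\bigr\}.$$ Proposition 5.2. Let $\gamma\in\mathbb C$. A function $F:\mathbb C\to\mathbb C$ belongs to $\psi\mathrm{pol}_N^\gamma(\mathbb C/\Lambda)$ if and only if all of the following hold: - $F$ is $C^1$-smooth (in the real sense); - $\bar\partial F(z)+NzF(z)=0$ for all $z\in\mathbb C$, where $\bar\partial=\frac12(\partial_x+i\,\partial_y)$, $z=x+iy$; - $F(z+\omega_j)=(-1)^N e^{2i\operatorname{Im}[\bar\omega_j(Nz-2\gamma)]}F(z)$ for all $z\in\mathbb C$ and $j=1,2$. In particular, $\psi\mathrm{pol}_N^\gamma(\mathbb C/\Lambda)$ is a complex linear subspace, of dimension $N$, of the space of functions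 $\mathbb C\to\mathbb C$. -/

import Mathlib

open scoped ComplexConjugate

noncomputable section

namespace TorusPseudopoly

/-- The Weierstrass sigma function of the lattice of `L`,
`σ(z) = z ∏_{0 ≠ ω ∈ Λ} (1 - z/ω) exp (z/ω + z²/(2ω²))`. -/
def sigma (L : PeriodPair) (z : ℂ) : ℂ :=
  z * ∏' ω : {ω : L.lattice // ω ≠ 0},
    ((1 - z / (ω : ℂ)) * Complex.exp (z / (ω : ℂ) + z ^ 2 / (2 * (ω : ℂ) ^ 2)))

/-- The Weierstrass zeta function of the lattice of `L`, i.e. the odd primitive of `-℘`: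
`ζ(z) = 1/z + ∑_{0 ≠ ω ∈ Λ} (1/(z-ω) + 1/ω + z/ω²)`. -/
def zeta (L : PeriodPair) (z : ℂ) : ℂ :=
  1 / z + ∑' ω : {ω : L.lattice // ω ≠ 0},
    (1 / (z - (ω : ℂ)) + 1 / (ω : ℂ) + z / (ω : ℂ) ^ 2)

/-- The quasi-period of the zeta function along `ω₁`: `λ₁ = 2 ζ(ω₁/2)`,
so that `ζ(z + ω₁) = ζ(z) + λ₁`. -/
def quasiPeriod₁ (L : PeriodPair) : ℂ := 2 * zeta L (L.ω₁ / 2)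

/-- The modified sigma function `σ_*(z) = exp (b z²) σ(z)`, `b = 1 - λ₁/(2ω₁)`. -/
def sigmaStar (L : PeriodPair) (z : ℂ) : ℂ :=
  Complex.exp ((1 - quasiPeriod₁ L / (2 * L.ω₁)) * z ^ 2) * sigma L z

/-- The monic pseudopolynomial of degree one with root `α`:
`π_α(z) = exp (2i Im (ᾱ z)) exp (-|z-α|²) σ_*(z-α)`. -/
def monicOne (L : PeriodPair) (α z : ℂ) : ℂ :=
  Complex.exp (2 * Complex.I * ((conj α * z).im : ℂ)) *
    Complex.exp (-((‖z - α‖ ^ 2 : ℝ) : ℂ)) * sigmaStar L (z - α)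

/-- The monic pseudopolynomial `Π_α = π_{α₁} ⋯ π_{α_N}` with roots `α₁, …, α_N`. -/
def monic (L : PeriodPair) {N : ℕ} (α : Fin N → ℂ) (z : ℂ) : ℂ :=
  ∏ j, monicOne L (α j) z

/-- The fiber over `γ`: the functions `c Π_α`, with `c ∈ ℂ` and `α ∈ ℂ^N` such that
`α₁ + ⋯ + α_N - γ ∈ Λ`. -/
def fiber (L : PeriodPair) (N : ℕ) (γ : ℂ) : Set (ℂ → ℂ) :=
  {F | ∃ (c : ℂ) (α : Fin N → ℂ), (∑ j, α j) - γ ∈ L.lattice ∧ F = fun z => c * monic L α z}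

/-- The Wirtinger derivative `∂̄F = (∂F/∂x + i ∂F/∂y) / 2` at `z = x + iy`. -/
def dbar (F : ℂ → ℂ) (z : ℂ) : ℂ :=
  (fderiv ℝ F z 1 + Complex.I * fderiv ℝ F z Complex.I) / 2

end TorusPseudopoly

end

noncomputable section

namespace TorusPseudopoly

open Filter Topology

/-! ### The Weierstrass elementary factor of genus two -/

/-! Multiplying `F` by `exp (N|z|²)` turns `∂̄F + NzF = 0` into holomorphy and the unimodular
multipliers into those of entire theta functions of degree `N` (`mul_weight_mem_thetaSpace_iff`).
The same weight turns `Π_α` into a product of translates of `σ_*` with exponential prefactors, so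
the proposition is a statement about factoring and counting theta functions.

A theta function of degree `d`, multiplied by a suitable `exp (βz)`, is `O(exp (d|z|²))`. By
Liouville, a nonzero one has `d ≥ 0`, and a zero-free one has `d = 0` (pass to `1/G`). Hence for `N
≥ 1` there is a zero; `σ_*` vanishes exactly on `Λ`, simply, so one factor splits off and the degree
drops by one. In degree zero only constants remain, and they force the parameter into `Λ`.

That `σ_*` has degree one is the Legendre relation (`legendre`), obtained without residues:
commutation of the two translations leaves an unknown integer degree `d`, and comparison with a
Jacobi theta function forces `d = 1`.

The dimension follows by induction from evaluation at a point, whose kernel is a copy of the space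
one degree lower. -/

lemma norm_elementaryFactor_sub_one_le {u : ℂ} (hu : ‖u‖ ≤ 1 / 2) :
    ‖(1 - u) * Complex.exp (u + u ^ 2 / 2) - 1‖ ≤ 2 * ‖u‖ ^ 3 := by
  have h1 : ‖-u‖ < 1 := by rw [norm_neg]; linarith
  -- The exponent cancels the Taylor polynomial of `log (1 - u)` through order two, leaving a cubic
  -- remainder.
  have h2 := Complex.norm_log_sub_logTaylor_le 2 h1
  have h3 : Complex.log (1 + -u) - Complex.logTaylor (2 + 1) (-u)
      = Complex.log (1 - u) + (u + u ^ 2 / 2) := by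
    simp [Complex.logTaylor_succ, Complex.logTaylor_zero]
    ring_nf
  rw [h3, norm_neg] at h2
  have hne : (1 - u) ≠ 0 := by
    intro h
    have : u = 1 := by linear_combination -h
    rw [this] at hu; norm_num at hu
  have h4 : (1 - u) * Complex.exp (u + u ^ 2 / 2)
      = Complex.exp (Complex.log (1 - u) + (u + u ^ 2 / 2)) := by
    rw [Complex.exp_add (Complex.log _), Complex.exp_log hne]
  have hpos := norm_nonneg u
  have h5 : ‖u‖ ^ (2 + 1) * (1 - ‖u‖)⁻¹ / ((2 : ℕ) + 1) ≤ ‖u‖ ^ 3 := by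
    have : (1 - ‖u‖)⁻¹ ≤ 2 := by
      rw [inv_le_comm₀ (by linarith) (by norm_num)]; linarith
    have h6 : 0 ≤ ‖u‖ ^ 3 := by positivity
    push_cast
    rw [div_le_iff₀ (by norm_num)]
    nlinarith
  have h7 := h2.trans h5
  have h8 : ‖u‖ ^ 3 ≤ 1 := pow_le_one₀ hpos (by linarith)
  rw [h4]
  exact (Complex.norm_exp_sub_one_le (h7.trans h8)).trans (by linarith)

/-- The factor of the sigma product at the lattice point `ω`. -/
def sigmaFactor (ω z : ℂ) : ℂ :=
  (1 - z / ω) * Complex.exp (z / ω + z ^ 2 / (2 * ω ^ 2))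

lemma differentiable_sigmaFactor (ω : ℂ) : Differentiable ℂ (sigmaFactor ω) := by
  unfold sigmaFactor
  fun_prop

lemma norm_sigmaFactor_sub_one_le {r : ℝ} {z ω : ℂ} (hr : 0 < r) (hz : ‖z‖ ≤ r)
    (hω : 2 * r ≤ ‖ω‖) : ‖sigmaFactor ω z - 1‖ ≤ 2 * r ^ 3 * ‖ω‖ ^ (-3 : ℝ) := by
  have hω0 : 0 < ‖ω‖ := by linarith
  have h1 : ‖z / ω‖ ≤ r / ‖ω‖ := by
    rw [norm_div]; gcongr
  have h2 : ‖z / ω‖ ≤ 1 / 2 := h1.trans (by rw [div_le_iff₀ hω0]; linarith)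
  have h3 := norm_elementaryFactor_sub_one_le h2
  have h4 : sigmaFactor ω z = (1 - z / ω) * Complex.exp (z / ω + (z / ω) ^ 2 / 2) := by
    unfold sigmaFactor
    congr 3
    rw [div_pow]; ring
  rw [h4]
  refine h3.trans ?_
  have h5 : ‖ω‖ ^ (-3 : ℝ) = (‖ω‖ ^ 3)⁻¹ := by
    rw [Real.rpow_neg hω0.le]; norm_cast
  rw [h5, mul_assoc, ← div_eq_mul_inv, ← div_pow]
  gcongr

/-! ### The sigma product: convergence, zeros, parity -/

variable (L : PeriodPair)

lemma summable_norm_rpow_neg_three :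
    Summable fun ω : {ω : L.lattice // ω ≠ 0} => ‖(ω : ℂ)‖ ^ (-3 : ℝ) := by
  have h := ZLattice.summable_norm_rpow L.lattice (-3)
    (by rw [PeriodPair.finrank_lattice]; norm_num)
  exact h.comp_injective Subtype.val_injective

lemma eventually_le_norm (r : ℝ) :
    ∀ᶠ ω : {ω : L.lattice // ω ≠ 0} in cofinite, r ≤ ‖(ω : ℂ)‖ := by
  have h1 : ∀ᶠ ω : L.lattice in cofinite, r ≤ ‖(ω : ℂ)‖ := by
    refine (isCompact_iff_finite.mp (isCompact_closedBall (0 : L.lattice) r)).subset ?_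
    intro l hl
    simp only [Set.mem_compl_iff, Set.mem_ofPred_eq, not_le] at hl
    simpa using hl.le
  exact (Function.Injective.tendsto_cofinite Subtype.val_injective).eventually h1

lemma eventually_norm_sigmaFactor_sub_one_le {r : ℝ} (hr : 0 < r) :
    ∀ᶠ ω : {ω : L.lattice // ω ≠ 0} in cofinite, ∀ z ∈ Metric.ball (0 : ℂ) r,
      ‖sigmaFactor ω z - 1‖ ≤ 2 * r ^ 3 * ‖(ω : ℂ)‖ ^ (-3 : ℝ) := by
  filter_upwards [eventually_le_norm L (2 * r)] with ω hω z hz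
  exact norm_sigmaFactor_sub_one_le hr (mem_ball_zero_iff.mp hz).le hω

lemma hasProdLocallyUniformlyOn_sigmaFactor {r : ℝ} (hr : 0 < r) :
    HasProdLocallyUniformlyOn (fun (ω : {ω : L.lattice // ω ≠ 0}) z => sigmaFactor ω z)
      (fun z => ∏' ω : {ω : L.lattice // ω ≠ 0}, sigmaFactor ω z) (Metric.ball 0 r) := by
  have := Summable.hasProdLocallyUniformlyOn_one_add (K := Metric.ball (0 : ℂ) r)
    (f := fun (ω : {ω : L.lattice // ω ≠ 0}) z => sigmaFactor ω z - 1) Metric.isOpen_ball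
    ((summable_norm_rpow_neg_three L).mul_left (2 * r ^ 3))
    (eventually_norm_sigmaFactor_sub_one_le L hr)
    (fun ω => ((differentiable_sigmaFactor ω).continuous.sub continuous_const).continuousOn)
  simpa using this

lemma differentiable_tprod_sigmaFactor :
    Differentiable ℂ (fun z => ∏' ω : {ω : L.lattice // ω ≠ 0}, sigmaFactor ω z) := by
  intro z
  have hr : 0 < ‖z‖ + 1 := by positivity
  have h := hasProdLocallyUniformlyOn_sigmaFactor L hr
  rw [hasProdLocallyUniformlyOn_iff_tendstoLocallyUniformlyOn] at h
  refine (h.differentiableOn (.of_forall fun s => ?_) Metric.isOpen_ball).differentiableAt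
    (Metric.isOpen_ball.mem_nhds (by simp))
  exact (Differentiable.fun_finsetProd fun ω _ => differentiable_sigmaFactor _).differentiableOn

lemma sigma_eq (z : ℂ) :
    sigma L z = z * ∏' ω : {ω : L.lattice // ω ≠ 0}, sigmaFactor ω z := rfl

lemma differentiable_sigma : Differentiable ℂ (sigma L) :=
  differentiable_id.mul (differentiable_tprod_sigmaFactor L)

lemma coe_ne_zero (ω : {ω : L.lattice // ω ≠ 0}) : (ω : ℂ) ≠ 0 :=
  fun h => ω.2 (Subtype.ext h)

lemma sigmaFactor_ne_zero {ω z : ℂ} (hω : ω ≠ 0) (h : z ≠ ω) : sigmaFactor ω z ≠ 0 := by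
  refine mul_ne_zero ?_ (Complex.exp_ne_zero _)
  rw [sub_ne_zero]
  intro h'
  exact h ((eq_div_iff hω).mp h' ▸ (one_mul _)).symm.symm

lemma sigma_eq_zero_of_mem {z : ℂ} (hz : z ∈ L.lattice) : sigma L z = 0 := by
  rw [sigma_eq]
  by_cases h0 : z = 0
  · simp [h0]
  · rw [tprod_of_exists_eq_zero, mul_zero]
    refine ⟨⟨⟨z, hz⟩, fun h => h0 (congrArg Subtype.val h)⟩, ?_⟩
    simp [sigmaFactor, h0]

/-- An absolutely convergent product vanishes only if one of its factors does. -/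
lemma tprod_sigmaFactor_ne_zero {z : ℂ} (hz : ∀ ω : {ω : L.lattice // ω ≠ 0}, z ≠ ω) :
    ∏' ω : {ω : L.lattice // ω ≠ 0}, sigmaFactor ω z ≠ 0 := by
  have := tprod_one_add_ne_zero_of_summable
    (f := fun ω : {ω : L.lattice // ω ≠ 0} => sigmaFactor ω z - 1) ?_ ?_
  · simpa using this
  · intro ω
    simpa using sigmaFactor_ne_zero (coe_ne_zero L ω) (hz ω)
  · have hr : 0 < ‖z‖ + 1 := by positivity
    refine ((summable_norm_rpow_neg_three L).mul_left
      (2 * (‖z‖ + 1) ^ 3)).of_norm_bounded_eventually ?_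
    filter_upwards [eventually_norm_sigmaFactor_sub_one_le L hr] with ω hω
    rw [norm_norm]
    exact hω z (by simp)

lemma sigma_ne_zero {z : ℂ} (hz : z ∉ L.lattice) : sigma L z ≠ 0 := by
  rw [sigma_eq]
  refine mul_ne_zero (fun h => hz (h ▸ zero_mem _)) (tprod_sigmaFactor_ne_zero L fun ω h => ?_)
  exact hz (h ▸ ω.1.2)

lemma sigma_eq_zero_iff {z : ℂ} : sigma L z = 0 ↔ z ∈ L.lattice :=
  ⟨fun h => by_contra fun hz => sigma_ne_zero L hz h, sigma_eq_zero_of_mem L⟩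

lemma deriv_sigma_zero_ne_zero : deriv (sigma L) 0 ≠ 0 := by
  have h : HasDerivAt (sigma L) _ 0 :=
    (hasDerivAt_id (0 : ℂ)).mul ((differentiable_tprod_sigmaFactor L) 0).hasDerivAt
  rw [h.deriv]
  simp [sigmaFactor]

/-- Negation of nonzero lattice points. -/
def negEquiv : {ω : L.lattice // ω ≠ 0} ≃ {ω : L.lattice // ω ≠ 0} where
  toFun ω := ⟨-ω.1, neg_ne_zero.mpr ω.2⟩
  invFun ω := ⟨-ω.1, neg_ne_zero.mpr ω.2⟩
  left_inv ω := by simp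
  right_inv ω := by simp

lemma sigma_neg (z : ℂ) : sigma L (-z) = -sigma L z := by
  rw [sigma_eq, sigma_eq, ← (negEquiv L).tprod_eq]
  simp only [negEquiv, Equiv.coe_fn_mk, sigmaFactor, NegMemClass.coe_neg, neg_div_neg_eq, even_two,
    Even.neg_pow, neg_mul]

lemma zeta_neg (z : ℂ) : zeta L (-z) = -zeta L z := by
  rw [zeta, zeta, ← (negEquiv L).tsum_eq, neg_add, ← tsum_neg]
  congr 1
  · rw [div_neg]
  · congr 1
    ext ω
    simp only [negEquiv, Equiv.coe_fn_mk, NegMemClass.coe_neg, even_two, Even.neg_pow]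
    rw [sub_neg_eq_add, neg_add_eq_sub, ← neg_sub z, div_neg, div_neg, neg_div]
    ring

/-! ### The zeta function and its increments along periods -/

lemma norm_zetaTerm_le {r : ℝ} (hr : 0 < r) {z l : ℂ} (hz : ‖z‖ < r) (h : 2 * r ≤ ‖l‖) :
    ‖1 / (z - l) + 1 / l + z / l ^ 2‖ ≤ 2 * r ^ 2 * ‖l‖ ^ (-3 : ℝ) := by
  have hl : 0 < ‖l‖ := by linarith
  have hl0 : l ≠ 0 := norm_pos_iff.mp hl
  have hzl : z - l ≠ 0 := by
    intro h0
    rw [sub_eq_zero.mp h0] at hz; linarith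
  have h1 : 1 / (z - l) + 1 / l + z / l ^ 2 = z ^ 2 / (l ^ 2 * (z - l)) := by
    field_simp; ring
  have h2 : ‖l‖ / 2 ≤ ‖z - l‖ := by
    rw [norm_sub_rev]; exact .trans (by linarith) (norm_sub_norm_le l z)
  have h5 : ‖l‖ ^ (-3 : ℝ) = (‖l‖ ^ 3)⁻¹ := by
    rw [Real.rpow_neg hl.le]; norm_cast
  rw [h1, norm_div, norm_mul, norm_pow, norm_pow, h5]
  calc ‖z‖ ^ 2 / (‖l‖ ^ 2 * ‖z - l‖) ≤ r ^ 2 / (‖l‖ ^ 2 * (‖l‖ / 2)) := by gcongr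
    _ = _ := by field_simp

lemma hasSumLocallyUniformly_zetaTerm :
    HasSumLocallyUniformly
      (fun (l : L.lattice) (z : ℂ) => 1 / (z - l) + 1 / (l : ℂ) + z / (l : ℂ) ^ 2)
      (fun z => ∑' l : L.lattice, (1 / (z - l) + 1 / (l : ℂ) + z / (l : ℂ) ^ 2)) := by
  refine L.hasSumLocallyUniformly_aux (u := fun r l => 2 * r ^ 2 * ‖l‖ ^ (-3 : ℝ)) _
    (fun _ _ => (ZLattice.summable_norm_rpow _ _ (by simp; norm_num)).mul_left _) fun r hr =>
    Filter.eventually_atTop.mpr ⟨2 * r, ?_⟩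
  rintro _ h s hs l rfl
  exact norm_zetaTerm_le hr hs h

/-- With the convention `x / 0 = 0`, the term at `l = 0` is exactly `1/z`, so the sum may run over
the whole lattice. -/
lemma zeta_eq_tsum :
    zeta L = fun z => ∑' l : L.lattice, (1 / (z - l) + 1 / (l : ℂ) + z / (l : ℂ) ^ 2) := by
  ext z
  have h := ((hasSumLocallyUniformly_zetaTerm L).hasSum (x := z)).summable
  have h2 := h.sum_add_tsum_subtype_compl ({0} : Finset L.lattice)
  rw [← h2, zeta]
  simp only [Finset.sum_singleton, ZeroMemClass.coe_zero, sub_zero, div_zero, add_zero, ne_eq,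
    OfNat.ofNat_ne_zero, not_false_eq_true, zero_pow]
  congr 1
  exact ((Equiv.subtypeEquivRight fun x : L.lattice => by simp).tsum_eq
    (fun ω : {x : L.lattice // x ≠ 0} => 1 / (z - (ω : ℂ)) + 1 / (ω : ℂ) + z / (ω : ℂ) ^ 2)).symm

lemma differentiableAt_zetaTerm {z l : ℂ} (h : z ≠ l) :
    DifferentiableAt ℂ (fun z : ℂ => 1 / (z - l) + 1 / l + z / l ^ 2) z := by
  have : z - l ≠ 0 := sub_ne_zero.mpr h
  fun_prop (disch := assumption)

lemma deriv_zetaTerm {z l : ℂ} (h : z ≠ l) :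
    deriv (fun z : ℂ => 1 / (z - l) + 1 / l + z / l ^ 2) z = -(1 / (z - l) ^ 2 - 1 / l ^ 2) := by
  have h0 : z - l ≠ 0 := sub_ne_zero.mpr h
  have h1 : HasDerivAt (fun z : ℂ => (z - l)⁻¹ + 1 / l + z / l ^ 2)
      (-1 / (z - l) ^ 2 + 1 / l ^ 2) z :=
    ((((hasDerivAt_id z).sub_const l).fun_inv h0).add_const (1 / l)).add
      ((hasDerivAt_id z).div_const (l ^ 2))
  simp only [one_div] at h1 ⊢
  rw [h1.deriv]
  ring

lemma ne_of_notMem {L : PeriodPair} {z : ℂ} (hz : z ∉ L.lattice) (l : L.lattice) : z ≠ l :=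
  fun h => hz (h ▸ l.2)

lemma isOpen_compl_lattice : IsOpen (L.lattice : Set ℂ)ᶜ := L.isClosed_lattice.isOpen_compl

lemma differentiableOn_zeta : DifferentiableOn ℂ (zeta L) (L.lattice : Set ℂ)ᶜ := by
  rw [zeta_eq_tsum]
  refine (hasSumLocallyUniformly_zetaTerm L).hasSumLocallyUniformlyOn.differentiableOn
    (.of_forall fun s => .fun_sum fun i _ => fun z hz => ?_) (isOpen_compl_lattice L)
  exact (differentiableAt_zetaTerm (ne_of_notMem hz i)).differentiableWithinAt

lemma deriv_zeta {z : ℂ} (hz : z ∉ L.lattice) : deriv (zeta L) z = -L.weierstrassP z := by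
  rw [zeta_eq_tsum]
  have h := ((hasSumLocallyUniformly_zetaTerm L).tendstoLocallyUniformlyOn.deriv
    (.of_forall fun s => .fun_sum fun i _ => fun z hz =>
      (differentiableAt_zetaTerm (ne_of_notMem hz i)).differentiableWithinAt)
    (isOpen_compl_lattice L)).tendsto_at (a := z) hz
  refine tendsto_nhds_unique h ?_
  refine (L.hasSum_weierstrassP z).neg.congr fun s => ?_
  simp only [Function.comp_apply]
  rw [deriv_fun_sum fun i _ => differentiableAt_zetaTerm (ne_of_notMem hz i)]
  exact Finset.sum_congr rfl fun i _ => (deriv_zetaTerm (ne_of_notMem hz i)).symm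

lemma isPreconnected_compl_lattice : IsPreconnected (L.lattice : Set ℂ)ᶜ := by
  have : (L.lattice : Set ℂ).Countable := by
    have : Countable L.lattice := L.latticeEquivProd.toEquiv.countable_iff.mpr inferInstance
    exact Set.countable_coe_iff.mp this
  exact (this.isPathConnected_compl_of_one_lt_rank
    (by rw [Complex.rank_real_complex]; norm_num)).isConnected.isPreconnected

lemma add_notMem {L : PeriodPair} {z ω : ℂ} (hω : ω ∈ L.lattice) (hz : z ∉ L.lattice) :
    z + ω ∉ L.lattice := fun h => hz (by simpa using sub_mem h hω)

/-- The increment has derivative zero because `℘` is periodic, and the complement of the lattice is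
connected. -/
lemma exists_zeta_add {ω : ℂ} (hω : ω ∈ L.lattice) :
    ∃ c : ℂ, ∀ z ∉ L.lattice, zeta L (z + ω) = zeta L z + c := by
  have hd : ∀ z ∉ L.lattice, DifferentiableAt ℂ (zeta L) z := fun z hz =>
    (differentiableOn_zeta L).differentiableAt ((isOpen_compl_lattice L).mem_nhds hz)
  have hd' : ∀ z ∉ L.lattice, DifferentiableAt ℂ (fun z => zeta L (z + ω)) z := fun z hz =>
    (hd _ (add_notMem hω hz)).comp (f := fun z => z + ω) z (by fun_prop)
  refine ⟨zeta L (L.ω₁ / 2 + ω) - zeta L (L.ω₁ / 2), fun z hz => ?_⟩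
  have := (isOpen_compl_lattice L).is_const_of_deriv_eq_zero (isPreconnected_compl_lattice L)
    (f := fun z => zeta L (z + ω) - zeta L z)
    (fun z hz => ((hd' z hz).sub (hd z hz)).differentiableWithinAt) (fun z hz => ?_)
    hz L.ω₁_div_two_notMem_lattice
  · linear_combination this
  · rw [deriv_fun_sub (hd' z hz) (hd z hz), deriv_comp_add_const,
      deriv_zeta L (add_notMem hω hz), deriv_zeta L hz]
    have := L.weierstrassP_add_coe z ⟨ω, hω⟩
    simp only at this
    simp [this]

/-! ### Quasi-periodicity and simple zeros of sigma -/

lemma logDeriv_sigmaFactor {z ω : ℂ} (hω : ω ≠ 0) (h : z ≠ ω) :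
    logDeriv (sigmaFactor ω) z = 1 / (z - ω) + 1 / ω + z / ω ^ 2 := by
  have h0 : z - ω ≠ 0 := sub_ne_zero.mpr h
  have h0' : ω - z ≠ 0 := sub_ne_zero.mpr h.symm
  have h1 : HasDerivAt (fun z : ℂ => 1 - z / ω) (-(1 / ω)) z := by
    simpa using ((hasDerivAt_id z).div_const ω).const_sub 1
  have h2 : HasDerivAt (fun z : ℂ => Complex.exp (z / ω + z ^ 2 / (2 * ω ^ 2)))
      (Complex.exp (z / ω + z ^ 2 / (2 * ω ^ 2)) * (1 / ω + 2 * z / (2 * ω ^ 2))) z := by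
    have := ((hasDerivAt_id z).div_const ω).add (((hasDerivAt_id z).pow 2).div_const (2 * ω ^ 2))
    simpa using this.cexp
  have h3 : HasDerivAt (sigmaFactor ω) _ z := h1.mul h2
  rw [logDeriv_apply, h3.deriv, sigmaFactor]
  have := Complex.exp_ne_zero (z / ω + z ^ 2 / (2 * ω ^ 2))
  generalize Complex.exp (z / ω + z ^ 2 / (2 * ω ^ 2)) = E at *
  have h4 : 1 - z / ω = (ω - z) / ω := by field_simp
  rw [h4]
  have h5 : z - ω = -(ω - z) := by ring
  rw [h5]
  field_simp
  ring

lemma logDeriv_sigma {z : ℂ} (hz : z ∉ L.lattice) : logDeriv (sigma L) z = zeta L z := by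
  have hz0 : z ≠ 0 := fun h => hz (h ▸ zero_mem _)
  have hr : 0 < ‖z‖ + 1 := by positivity
  have hne : ∀ ω : {ω : L.lattice // ω ≠ 0}, z ≠ ω := fun ω => ne_of_notMem hz ω.1
  have hld := fun ω : {ω : L.lattice // ω ≠ 0} => logDeriv_sigmaFactor (coe_ne_zero L ω) (hne ω)
  have h1 := logDeriv_tprod_eq_tsum (s := Metric.ball 0 (‖z‖ + 1)) (x := z)
    (f := fun ω : {ω : L.lattice // ω ≠ 0} => sigmaFactor ω) Metric.isOpen_ball (by simp)
    (fun ω => sigmaFactor_ne_zero (coe_ne_zero L ω) (hne ω))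
    (fun ω => (differentiable_sigmaFactor ω).differentiableOn)
    (by
      simp only [hld]
      exact ((hasSumLocallyUniformly_zetaTerm L).hasSum (x := z)).summable.comp_injective
        Subtype.val_injective)
    (hasProdLocallyUniformlyOn_sigmaFactor L hr).multipliableLocallyUniformlyOn
    (tprod_sigmaFactor_ne_zero L hne)
  have h2 : logDeriv (sigma L) z = logDeriv (fun z => z * ∏' ω : {ω : L.lattice // ω ≠ 0},
    sigmaFactor ω z) z := rfl
  rw [h2, logDeriv_mul (f := fun z => z) z hz0 (tprod_sigmaFactor_ne_zero L hne)
    differentiableAt_fun_id (differentiable_tprod_sigmaFactor L z), h1, zeta]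
  simp only [hld]
  congr 1
  simp [logDeriv_apply]

/-- Quasi-periodicity of sigma along an arbitrary lattice vector, with the constants expressed by
the increment `c` of zeta. -/
lemma exists_sigma_add {ω c : ℂ} (hω : ω ∈ L.lattice)
    (hc : ∀ z ∉ L.lattice, zeta L (z + ω) = zeta L z + c) :
    ∃ C : ℂ, C ≠ 0 ∧ ∀ z, sigma L (z + ω) = C * Complex.exp (c * z) * sigma L z := by
  set h : ℂ → ℂ := fun z => sigma L (z + ω) / (Complex.exp (c * z) * sigma L z) with hh
  have hden : ∀ z ∉ L.lattice, Complex.exp (c * z) * sigma L z ≠ 0 := fun z hz =>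
    mul_ne_zero (Complex.exp_ne_zero _) (sigma_ne_zero L hz)
  have hds := differentiable_sigma L
  have hd : ∀ z ∉ L.lattice, DifferentiableAt ℂ h z := fun z hz => by
    refine DifferentiableAt.div ?_ ?_ (hden z hz) <;> fun_prop
  have hderiv : ∀ z ∉ L.lattice, deriv h z = 0 := fun z hz => by
    have hz' := add_notMem hω hz
    have e1 := logDeriv_sigma L hz
    have e2 := logDeriv_sigma L hz'
    have e3 := hc z hz
    have n1 := sigma_ne_zero L hz
    have n2 := sigma_ne_zero L hz'
    rw [logDeriv_apply, div_eq_iff n1] at e1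
    rw [logDeriv_apply, div_eq_iff n2] at e2
    have d1 : HasDerivAt (fun z => sigma L (z + ω)) (deriv (sigma L) (z + ω)) z :=
      (hds (z + ω)).hasDerivAt.comp_add_const ..
    have d2 : HasDerivAt (fun z => Complex.exp (c * z)) (Complex.exp (c * z) * c) z := by
      simpa using ((hasDerivAt_id z).const_mul c).cexp
    have d3 := d1.div (d2.mul (hds z).hasDerivAt) (hden z hz)
    refine d3.deriv.trans ?_
    rw [e1, e2, e3, div_eq_zero_iff]
    left
    simp only [Pi.mul_apply]
    ring
  refine ⟨h (L.ω₁ / 2), div_ne_zero (sigma_ne_zero L (add_notMem hω L.ω₁_div_two_notMem_lattice))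
    (hden _ L.ω₁_div_two_notMem_lattice), fun z => ?_⟩
  by_cases hz : z ∈ L.lattice
  · rw [sigma_eq_zero_of_mem L hz, sigma_eq_zero_of_mem L (add_mem hz hω), mul_zero]
  · have := (isOpen_compl_lattice L).is_const_of_deriv_eq_zero (isPreconnected_compl_lattice L)
      (f := h) (fun z hz => (hd z hz).differentiableWithinAt) (fun z hz => hderiv z hz)
      L.ω₁_div_two_notMem_lattice hz
    rw [this, hh]
    have := hden z hz
    simp only
    rw [mul_assoc, div_mul_cancel₀ _ this]

/-- Quasi-periodicity of sigma along a primitive period. -/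
lemma sigma_add {ω : ℂ} (hω : ω ∈ L.lattice) (hω2 : ω / 2 ∉ L.lattice) (z : ℂ) :
    sigma L (z + ω) = -Complex.exp (2 * zeta L (ω / 2) * (z + ω / 2)) * sigma L z := by
  have hm : -(ω / 2) ∉ L.lattice := fun h => hω2 (by simpa using neg_mem h)
  obtain ⟨c, hc⟩ := exists_zeta_add L hω
  obtain ⟨C, -, hC⟩ := exists_sigma_add L hω hc
  -- The point `-ω/2` is moved to its negative by `ω`; oddness of zeta and of sigma there determines
  -- both `c` and `C`.
  have h1 : c = 2 * zeta L (ω / 2) := by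
    have := hc _ hm
    rw [zeta_neg, show -(ω / 2) + ω = ω / 2 by ring] at this
    linear_combination -this
  have h2 := hC (-(ω / 2))
  rw [sigma_neg, show -(ω / 2) + ω = ω / 2 by ring] at h2
  have h3 : C = -Complex.exp (c * (ω / 2)) := by
    have : C * Complex.exp (c * -(ω / 2)) = -1 :=
      mul_right_cancel₀ (sigma_ne_zero L hω2) (by linear_combination h2)
    rw [mul_neg, Complex.exp_neg] at this
    have hE := Complex.exp_ne_zero (c * (ω / 2))
    field_simp at this
    rw [this]
    ring_nf
  rw [hC, h3, ← h1, mul_add, Complex.exp_add]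
  ring

/-- Quasi-periodicity transports the simple zero at the origin to every lattice point. -/
lemma deriv_sigma_ne_zero {ω : ℂ} (hω : ω ∈ L.lattice) : deriv (sigma L) ω ≠ 0 := by
  obtain ⟨c, hc⟩ := exists_zeta_add L hω
  obtain ⟨C, hC0, hC⟩ := exists_sigma_add L hω hc
  have hds := differentiable_sigma L
  have d1 : HasDerivAt (fun z => sigma L (z + ω)) (deriv (sigma L) (0 + ω)) 0 :=
    (hds (0 + ω)).hasDerivAt.comp_add_const ..
  have d2 : HasDerivAt (fun z => C * Complex.exp (c * z)) (C * (Complex.exp (c * 0) * c)) 0 := by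
    simpa using (((hasDerivAt_id (0 : ℂ)).const_mul c).cexp).const_mul C
  have d3 := d2.mul (hds 0).hasDerivAt
  have e := d1.unique (d3.congr_of_eventuallyEq (.of_forall hC))
  rw [zero_add] at e
  rw [e, sigma_eq_zero_of_mem L (zero_mem _)]
  simpa using ⟨hC0, deriv_sigma_zero_ne_zero L⟩

/-- An entire function vanishing on the zero set of an entire function with simple zeros is
divisible by it. -/
lemma exists_eq_mul_of_simple_zeros {f g : ℂ → ℂ} (hf : Differentiable ℂ f)
    (hg : Differentiable ℂ g) (hsimple : ∀ z, g z = 0 → deriv g z ≠ 0)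
    (hzero : ∀ z, g z = 0 → f z = 0) :
    ∃ q : ℂ → ℂ, Differentiable ℂ q ∧ ∀ z, f z = q z * g z := by
  classical
  -- Near a zero `z₀` of `g` this quotient agrees with that of the entire functions `dslope f z₀`
  -- and `dslope g z₀`, the latter nonzero at `z₀`.
  refine ⟨fun z => if g z = 0 then deriv f z / deriv g z else f z / g z, fun z₀ => ?_, fun z => ?_⟩
  · by_cases h0 : g z₀ = 0
    · have dfs : Differentiable ℂ (dslope f z₀) := differentiableOn_univ.mp
        ((Complex.differentiableOn_dslope univ_mem).mpr hf.differentiableOn)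
      have dgs : Differentiable ℂ (dslope g z₀) := differentiableOn_univ.mp
        ((Complex.differentiableOn_dslope univ_mem).mpr hg.differentiableOn)
      have hne : dslope g z₀ z₀ ≠ 0 := by rw [dslope_same]; exact hsimple _ h0
      refine ((dfs z₀).div (dgs z₀) hne).congr_of_eventuallyEq ?_
      filter_upwards [(dgs z₀).continuousAt.eventually_ne hne] with z hz
      by_cases hzz : z = z₀
      · subst hzz
        simp [h0]
      · have e1 : g z = (z - z₀) * dslope g z₀ z := by
          have := sub_smul_dslope g z₀ z
          rw [h0, sub_zero, smul_eq_mul] at this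
          exact this.symm
        have e2 : f z = (z - z₀) * dslope f z₀ z := by
          have := sub_smul_dslope f z₀ z
          rw [hzero _ h0, sub_zero, smul_eq_mul] at this
          exact this.symm
        have hsub : z - z₀ ≠ 0 := sub_ne_zero.mpr hzz
        have : g z ≠ 0 := by rw [e1]; exact mul_ne_zero hsub hz
        rw [if_neg this, e1, e2, mul_div_mul_left _ _ hsub, Pi.div_apply]
    · refine ((hf z₀).div (hg z₀) h0).congr_of_eventuallyEq ?_
      filter_upwards [(hg z₀).continuousAt.eventually_ne h0] with z hz
      rw [if_neg hz, Pi.div_apply]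
  · by_cases h : g z = 0
    · simp [h, hzero z h]
    · simp [h]

/-! ### Theta functions of integer degree: growth and zeros -/

variable {L}

lemma periodic_of_mem_lattice {α : Type*} {u : ℂ → α} (h₁ : ∀ z, u (z + L.ω₁) = u z)
    (h₂ : ∀ z, u (z + L.ω₂) = u z) {ω : ℂ} (hω : ω ∈ L.lattice) (z : ℂ) : u (z + ω) = u z := by
  obtain ⟨m, n, rfl⟩ := PeriodPair.mem_lattice.mp hω
  have p1 : Function.Periodic u (m * L.ω₁) := Function.Periodic.int_mul h₁ m
  have p2 : Function.Periodic u (n * L.ω₂) := Function.Periodic.int_mul h₂ n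
  exact p1.add_period p2 z

lemma exists_bound_of_periodic {u : ℂ → ℝ} (hu : Continuous u) (h₁ : ∀ z, u (z + L.ω₁) = u z)
    (h₂ : ∀ z, u (z + L.ω₂) = u z) : ∃ C, ∀ z, u z ≤ C := by
  have hK : IsCompact (closure (ZSpan.fundamentalDomain L.basis)) :=
    (ZSpan.fundamentalDomain_isBounded L.basis).isCompact_closure
  obtain ⟨C, hC⟩ := (hK.image hu).bddAbove
  refine ⟨C, fun z => ?_⟩
  have hmem : (ZSpan.floor L.basis z : ℂ) ∈ L.lattice := by
    rw [L.lattice_eq_span_range_basis]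
    exact (ZSpan.floor L.basis z).2
  have hz : z = ZSpan.fract L.basis z + ZSpan.floor L.basis z := by
    rw [ZSpan.fract_apply]; ring
  rw [hz, periodic_of_mem_lattice h₁ h₂ hmem]
  exact hC ⟨_, subset_closure (ZSpan.fract_mem_fundamentalDomain L.basis z), rfl⟩

/-- Entire theta functions of degree `d` for the lattice of `L`. -/
structure IsTheta (L : PeriodPair) (d : ℤ) (G : ℂ → ℂ) : Prop where
  differentiable : Differentiable ℂ G
  add_period : ∀ ω ∈ ({L.ω₁, L.ω₂} : Set ℂ), ∃ c : ℂ, c ≠ 0 ∧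
    ∀ z, G (z + ω) = c * Complex.exp (2 * d * conj ω * z) * G z

lemma IsTheta.comp_sub {d : ℤ} {G : ℂ → ℂ} (hG : IsTheta L d G) (α : ℂ) :
    IsTheta L d (fun z => G (z - α)) := by
  have hd := hG.differentiable
  refine ⟨by fun_prop, fun ω hω => ?_⟩
  obtain ⟨a, ha, hGa⟩ := hG.add_period ω hω
  refine ⟨a * Complex.exp (-(2 * d * conj ω * α)), mul_ne_zero ha (Complex.exp_ne_zero _),
    fun z => ?_⟩
  rw [add_sub_right_comm, hGa, mul_assoc a (Complex.exp _) (Complex.exp _), ← Complex.exp_add]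
  ring_nf

/-- If `F = q G` and both `F` and `G` are quasi-periodic along `ω`, then so is `q`. -/
lemma quasiPeriodic_of_mul {F G q A B : ℂ → ℂ} {ω : ℂ} (hG : Differentiable ℂ G)
    (hq : Differentiable ℂ q) (hA : Differentiable ℂ A) (hB : ∀ z, B z ≠ 0)
    (h : ∀ z, F z = q z * G z) (hF' : ∀ z, F (z + ω) = A z * B z * F z)
    (hG' : ∀ z, G (z + ω) = B z * G z) (hG0 : ∃ z, G z ≠ 0) (z : ℂ) :
    q (z + ω) = A z * q z := by
  obtain ⟨z₀, hz₀⟩ := hG0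
  have key : (fun z => q (z + ω)) = fun z => A z * q z := by
    -- Cancelling `G` is legitimate only where it does not vanish; the identity theorem extends the
    -- relation to the plane.
    refine AnalyticOnNhd.eq_of_eventuallyEq (𝕜 := ℂ) (z₀ := z₀) ?_ ?_ ?_
    · exact (Differentiable.differentiableOn (by fun_prop)).analyticOnNhd isOpen_univ
    · exact (Differentiable.differentiableOn (by fun_prop)).analyticOnNhd isOpen_univ
    · filter_upwards [(hG z₀).continuousAt.eventually_ne hz₀] with z hz
      have h1 := hF' z
      rw [h, h, hG'] at h1
      exact mul_right_cancel₀ (mul_ne_zero (hB z) hz) (by linear_combination h1)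
  exact congrFun key z

lemma IsTheta.of_mul {d e : ℤ} {F G q : ℂ → ℂ} (hF : IsTheta L d F) (hG : IsTheta L e G)
    (hq : Differentiable ℂ q) (h : ∀ z, F z = q z * G z) (hG0 : ∃ z, G z ≠ 0) :
    IsTheta L (d - e) q := by
  refine ⟨hq, fun ω hω => ?_⟩
  obtain ⟨a, ha, hFa⟩ := hF.add_period ω hω
  obtain ⟨b, hb, hGb⟩ := hG.add_period ω hω
  refine ⟨a / b, div_ne_zero ha hb, quasiPeriodic_of_mul hG.differentiable hq
    (by fun_prop) (fun z => mul_ne_zero hb (Complex.exp_ne_zero _)) h (fun z => ?_) hGb hG0⟩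
  have : Complex.exp (2 * d * conj ω * z)
      = Complex.exp (2 * (d - e : ℤ) * conj ω * z) * Complex.exp (2 * e * conj ω * z) := by
    rw [← Complex.exp_add]; push_cast; ring_nf
  rw [hFa, this]
  field_simp

lemma IsTheta.inv {d : ℤ} {G : ℂ → ℂ} (hG : IsTheta L d G) (h : ∀ z, G z ≠ 0) :
    IsTheta L (-d) (fun z => (G z)⁻¹) := by
  refine ⟨hG.differentiable.inv h, fun ω hω => ?_⟩
  obtain ⟨a, ha, hGa⟩ := hG.add_period ω hω
  refine ⟨a⁻¹, inv_ne_zero ha, fun z => ?_⟩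
  rw [hGa, mul_inv, mul_inv, ← Complex.exp_neg]
  push_cast
  ring_nf

lemma exists_re_mul_eq (h₁ : L.ω₁.im = 0) (h₁' : 0 < L.ω₁.re) (h₂ : 0 < L.ω₂.im) (r₁ r₂ : ℝ) :
    ∃ β : ℂ, (β * L.ω₁).re = r₁ ∧ (β * L.ω₂).re = r₂ := by
  refine ⟨⟨r₁ / L.ω₁.re, (r₁ / L.ω₁.re * L.ω₂.re - r₂) / L.ω₂.im⟩, ?_, ?_⟩
  · simp only [Complex.mul_re, h₁]; field_simp; ring
  · simp only [Complex.mul_re]; field_simp; ring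

lemma norm_add_sq (z ω : ℂ) : ‖z + ω‖ ^ 2 = ‖z‖ ^ 2 + ‖ω‖ ^ 2 + 2 * (conj ω * z).re := by
  rw [Complex.sq_norm, Complex.sq_norm, Complex.sq_norm, Complex.normSq_add]
  simp [Complex.mul_re]; ring

/-- For suitable `β`, `|G(z) exp (βz)| exp (-d|z|²)` is doubly periodic, hence bounded. The two
conditions on `β` fix `Re (βω₁)` and `Re (βω₂)`, and are solvable since the periods are independent
over the reals. -/
lemma IsTheta.exists_bound {d : ℤ} {G : ℂ → ℂ} (hG : IsTheta L d G)
    (h₁ : L.ω₁.im = 0) (h₁' : 0 < L.ω₁.re) (h₂ : 0 < L.ω₂.im) :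
    ∃ (β : ℂ) (C : ℝ), ∀ z, ‖G z * Complex.exp (β * z)‖ ≤ C * Real.exp (d * ‖z‖ ^ 2) := by
  obtain ⟨c₁, hc₁, hG₁⟩ := hG.add_period L.ω₁ (by simp)
  obtain ⟨c₂, hc₂, hG₂⟩ := hG.add_period L.ω₂ (by simp)
  obtain ⟨β, hβ₁, hβ₂⟩ := exists_re_mul_eq h₁ h₁' h₂
    (d * ‖L.ω₁‖ ^ 2 - Real.log ‖c₁‖) (d * ‖L.ω₂‖ ^ 2 - Real.log ‖c₂‖)
  have hper : ∀ {ω c : ℂ}, c ≠ 0 → (∀ z, G (z + ω) = c * Complex.exp (2 * d * conj ω * z) * G z) →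
      (β * ω).re = d * ‖ω‖ ^ 2 - Real.log ‖c‖ → ∀ z,
      ‖G (z + ω) * Complex.exp (β * (z + ω))‖ * Real.exp (-(d * ‖z + ω‖ ^ 2))
        = ‖G z * Complex.exp (β * z)‖ * Real.exp (-(d * ‖z‖ ^ 2)) := by
    intro ω c hc h hβ z
    have hre : (2 * (d : ℂ) * conj ω * z).re = 2 * d * (conj ω * z).re := by
      rw [show 2 * (d : ℂ) * conj ω * z = ((2 * d : ℝ) : ℂ) * (conj ω * z) by push_cast; ring,
        Complex.re_ofReal_mul]
    rw [h, norm_add_sq, norm_mul, norm_mul, norm_mul, norm_mul, Complex.norm_exp, Complex.norm_exp,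
      Complex.norm_exp, hre, mul_add, Complex.add_re, hβ]
    have hlog := Real.exp_log (norm_pos_iff.mpr hc)
    conv_lhs => rw [← hlog]
    have : ∀ a b e f : ℝ, Real.exp a * Real.exp b * ‖G z‖ * Real.exp e * Real.exp f
        = ‖G z‖ * Real.exp (a + b + e + f) := by
      intro a b e f; rw [Real.exp_add, Real.exp_add, Real.exp_add]; ring
    rw [this, mul_assoc ‖G z‖, ← Real.exp_add, Real.log_exp]
    congr 2; ring
  have hcont : Continuous fun z => ‖G z * Complex.exp (β * z)‖ * Real.exp (-(d * ‖z‖ ^ 2)) := by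
    have := hG.differentiable.continuous
    fun_prop
  obtain ⟨C, hC⟩ := exists_bound_of_periodic (L := L) hcont (hper hc₁ hG₁ hβ₁) (hper hc₂ hG₂ hβ₂)
  refine ⟨β, C, fun z => ?_⟩
  have := hC z
  rwa [Real.exp_neg, ← div_eq_mul_inv, div_le_iff₀ (Real.exp_pos _)] at this

/-- Liouville applied to `G(z) exp (βz)`; for `d < 0` the bound also tends to zero, which kills the
constant. -/
lemma IsTheta.exists_eq_const_mul_exp {d : ℤ} (hd : d ≤ 0) {G : ℂ → ℂ} (hG : IsTheta L d G)
    (h₁ : L.ω₁.im = 0) (h₁' : 0 < L.ω₁.re) (h₂ : 0 < L.ω₂.im) :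
    ∃ K β : ℂ, (∀ z, G z = K * Complex.exp (β * z)) ∧ (d < 0 → K = 0) := by
  obtain ⟨β, C, hC⟩ := hG.exists_bound h₁ h₁' h₂
  have hd' : (d : ℝ) ≤ 0 := by exact_mod_cast hd
  have hC0 : 0 ≤ C := by simpa using (norm_nonneg _).trans (hC 0)
  have hdiff : Differentiable ℂ fun z => G z * Complex.exp (β * z) := by
    have := hG.differentiable
    fun_prop
  have hconst : ∀ z, G z * Complex.exp (β * z) = G 0 := fun z => by
    have := hdiff.apply_eq_apply_of_bounded (isBounded_iff_forall_norm_le.mpr ⟨C, ?_⟩) z 0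
    · simpa using this
    · rintro _ ⟨w, rfl⟩
      refine (hC w).trans (mul_le_of_le_one_right hC0 (Real.exp_le_one_iff.mpr ?_))
      exact mul_nonpos_of_nonpos_of_nonneg hd' (by positivity)
  refine ⟨G 0, -β, fun z => ?_, fun hneg => ?_⟩
  · rw [← hconst z, mul_assoc, ← Complex.exp_add]
    simp
  · have hneg' : (d : ℝ) < 0 := by exact_mod_cast hneg
    have hlim : Tendsto (fun r : ℝ => C * Real.exp (d * r ^ 2)) atTop (𝓝 0) := by
      rw [← mul_zero C]
      refine (Real.tendsto_exp_atBot.comp ?_).const_mul C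
      exact (tendsto_pow_atTop two_ne_zero).const_mul_atTop_of_neg hneg'
    rw [← norm_le_zero_iff]
    refine ge_of_tendsto hlim ?_
    filter_upwards [eventually_ge_atTop 0] with r hr
    have := hC (r : ℂ)
    rwa [hconst, Complex.norm_real, Real.norm_of_nonneg hr] at this

lemma IsTheta.nonneg {d : ℤ} {G : ℂ → ℂ} (hG : IsTheta L d G) (h0 : ∃ z, G z ≠ 0)
    (h₁ : L.ω₁.im = 0) (h₁' : 0 < L.ω₁.re) (h₂ : 0 < L.ω₂.im) : 0 ≤ d := by
  by_contra! hd
  obtain ⟨K, β, h, hK⟩ := hG.exists_eq_const_mul_exp hd.le h₁ h₁' h₂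
  obtain ⟨z, hz⟩ := h0
  exact hz (by rw [h, hK hd, zero_mul])

/-- If `G` had no zero, `1/G` would be a theta function of degree `-d`, and both degrees would be
nonnegative. -/
lemma IsTheta.exists_zero {d : ℤ} {G : ℂ → ℂ} (hG : IsTheta L d G) (hd : d ≠ 0)
    (h₁ : L.ω₁.im = 0) (h₁' : 0 < L.ω₁.re) (h₂ : 0 < L.ω₂.im) : ∃ z, G z = 0 := by
  by_contra! h
  have a := hG.nonneg ⟨0, h 0⟩ h₁ h₁' h₂
  have b := (hG.inv h).nonneg ⟨0, inv_ne_zero (h 0)⟩ h₁ h₁' h₂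
  omega

lemma IsTheta.apply_add_eq_zero {d : ℤ} {G : ℂ → ℂ} (hG : IsTheta L d G) {ω : ℂ}
    (hω : ω ∈ L.lattice) {z : ℂ} (hz : G z = 0) : G (z + ω) = 0 := by
  have hper : ∀ ω ∈ ({L.ω₁, L.ω₂} : Set ℂ), ∀ z, (G (z + ω) = 0) = (G z = 0) := by
    intro ω hω z
    obtain ⟨c, hc, h⟩ := hG.add_period ω hω
    rw [h]
    simp [hc, Complex.exp_ne_zero]
  exact (periodic_of_mem_lattice (u := fun z => G z = 0) (hper _ (by simp)) (hper _ (by simp))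
    hω z).mpr hz

/-! ### A nonzero theta function of degree one -/

/-- The zeroth Fourier coefficient along the real axis equals 1. -/
lemma exists_jacobiTheta₂_ne_zero {τ : ℂ} (hτ : 0 < τ.im) : ∃ z, jacobiTheta₂ z τ ≠ 0 := by
  by_contra! h
  have hterm : ∀ n : ℤ, Continuous fun x : ℝ => jacobiTheta₂_term n x τ := fun n => by
    unfold jacobiTheta₂_term
    fun_prop
  have hnorm : ∀ (n : ℤ) (x : ℝ), ‖jacobiTheta₂_term n x τ‖ = ‖jacobiTheta₂_term n 0 τ‖ := by
    intro n x
    rw [norm_jacobiTheta₂_term, norm_jacobiTheta₂_term]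
    simp
  have hsum : Summable fun n : ℤ => ‖jacobiTheta₂_term n 0 τ‖ :=
    ((summable_jacobiTheta₂_term_iff 0 τ).mpr hτ).norm
  have hint := intervalIntegral.hasSum_integral_of_dominated_convergence (a := 0) (b := 1)
    (μ := MeasureTheory.volume) (F := fun (n : ℤ) (x : ℝ) => jacobiTheta₂_term n x τ)
    (f := fun _ => 0) (fun n _ => ‖jacobiTheta₂_term n 0 τ‖)
    (fun n => (hterm n).aestronglyMeasurable)
    (fun n => .of_forall fun x _ => (hnorm n x).le)
    (.of_forall fun x _ => hsum) (by simp)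
    (.of_forall fun x _ => by
      have := hasSum_jacobiTheta₂_term (x : ℂ) hτ
      rwa [h] at this)
  have hz : ∀ n : ℤ, n ≠ 0 → ∫ x in (0 : ℝ)..1, jacobiTheta₂_term n x τ = 0 := by
    intro n hn
    have hc : (2 * Real.pi * Complex.I * n : ℂ) ≠ 0 := by
      simp [hn, Real.pi_ne_zero]
    have : ∀ x : ℝ, jacobiTheta₂_term n x τ =
        Complex.exp (2 * Real.pi * Complex.I * n * x) * Complex.exp (Real.pi * Complex.I * n ^ 2 * τ) := by
      intro x
      rw [jacobiTheta₂_term, Complex.exp_add]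
    simp only [this]
    rw [intervalIntegral.integral_mul_const, integral_exp_mul_complex hc]
    have : Complex.exp (2 * Real.pi * Complex.I * n * (1 : ℝ)) = 1 :=
      Complex.exp_eq_one_iff.mpr ⟨n, by push_cast; ring⟩
    rw [this]
    simp
  have h0 : ∫ x in (0 : ℝ)..1, jacobiTheta₂_term 0 x τ = 1 := by
    simp [jacobiTheta₂_term]
  have h2 := hint.unique (hasSum_single (0 : ℤ) fun n hn => hz n hn)
  rw [h0] at h2
  simp at h2

/-- A nonzero theta function of degree one. -/
lemma exists_isTheta_one (h₁ : L.ω₁.im = 0) (h₁' : 0 < L.ω₁.re) (h₂ : 0 < L.ω₂.im)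
    (harea : L.ω₁.re * L.ω₂.im = Real.pi / 2) :
    ∃ G : ℂ → ℂ, IsTheta L 1 G ∧ ∃ z, G z ≠ 0 := by
  have hω₁ : L.ω₁ = (L.ω₁.re : ℂ) := Complex.ext (by simp) (by simp [h₁])
  have hω₁0 : L.ω₁ ≠ 0 := by rw [hω₁]; exact_mod_cast h₁'.ne'
  have hconj : conj L.ω₁ = L.ω₁ := Complex.conj_eq_iff_im.mpr h₁
  have hτ : 0 < (L.ω₂ / L.ω₁).im := by
    rw [hω₁, Complex.div_ofReal_im]; positivity
  have hconj₂ : conj L.ω₂ = L.ω₂ - Real.pi * Complex.I / L.ω₁ := by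
    have e1 : conj L.ω₂ = L.ω₂ - 2 * L.ω₂.im * Complex.I := by
      apply Complex.ext <;> simp; ring
    have e2 : L.ω₁ * (L.ω₂.im : ℂ) = Real.pi / 2 := by
      rw [hω₁]; exact_mod_cast harea
    rw [e1]
    field_simp
    linear_combination (-2 * Complex.I) * e2
  -- The Gaussian contributes `exp (2ωz)` along each period. Along `ω₂` the Jacobi factor `exp
  -- (-2πiz/ω₁)` corrects `ω₂` to `conj ω₂`, by the area normalization.
  refine ⟨fun z => Complex.exp (z ^ 2) * jacobiTheta₂ (z / L.ω₁) (L.ω₂ / L.ω₁), ⟨?_, ?_⟩, ?_⟩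
  · intro z
    have := (differentiableAt_jacobiTheta₂_fst (z / L.ω₁) hτ).comp z
      (f := fun z => z / L.ω₁) (by fun_prop)
    exact DifferentiableAt.mul (by fun_prop) this
  · rintro ω (rfl | rfl)
    · refine ⟨Complex.exp (L.ω₁ ^ 2), Complex.exp_ne_zero _, fun z => ?_⟩
      rw [add_div, div_self hω₁0, jacobiTheta₂_add_left, hconj, ← mul_assoc, ← Complex.exp_add,
        ← Complex.exp_add]
      congr 2
      push_cast; ring
    · refine ⟨Complex.exp (L.ω₂ ^ 2 - Real.pi * Complex.I * (L.ω₂ / L.ω₁)), Complex.exp_ne_zero _,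
        fun z => ?_⟩
      rw [add_div, jacobiTheta₂_add_left', hconj₂, ← mul_assoc, ← mul_assoc, ← Complex.exp_add,
        ← Complex.exp_add, ← Complex.exp_add]
      congr 2
      push_cast
      field_simp
      ring
  · obtain ⟨z, hz⟩ := exists_jacobiTheta₂_ne_zero hτ
    refine ⟨z * L.ω₁, mul_ne_zero (Complex.exp_ne_zero _) ?_⟩
    rwa [mul_div_cancel_right₀ _ hω₁0]

/-! ### Gaussian multiples of sigma and the Legendre relation -/

/-- The sigma function multiplied by a Gaussian `exp (a z²)`. -/
def gaussSigma (L : PeriodPair) (a z : ℂ) : ℂ := Complex.exp (a * z ^ 2) * sigma L z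

section gaussSigma

variable (L) (a : ℂ)

lemma differentiable_gaussSigma : Differentiable ℂ (gaussSigma L a) := by
  have := differentiable_sigma L
  unfold gaussSigma
  fun_prop

lemma gaussSigma_eq_zero_iff {z : ℂ} : gaussSigma L a z = 0 ↔ z ∈ L.lattice := by
  simp [gaussSigma, Complex.exp_ne_zero, sigma_eq_zero_iff]

lemma deriv_gaussSigma_ne_zero {z : ℂ} (hz : z ∈ L.lattice) : deriv (gaussSigma L a) z ≠ 0 := by
  have h1 : DifferentiableAt ℂ (fun z : ℂ => Complex.exp (a * z ^ 2)) z := by fun_prop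
  have h2 : HasDerivAt (gaussSigma L a) _ z :=
    h1.hasDerivAt.mul (differentiable_sigma L z).hasDerivAt
  rw [h2.deriv, sigma_eq_zero_of_mem L hz, mul_zero, zero_add]
  exact mul_ne_zero (Complex.exp_ne_zero _) (deriv_sigma_ne_zero L hz)

lemma gaussSigma_add {ω : ℂ} (hω : ω ∈ L.lattice) (hω2 : ω / 2 ∉ L.lattice) (z : ℂ) :
    gaussSigma L a (z + ω) =
      -Complex.exp ((2 * a * ω + 2 * zeta L (ω / 2)) * (z + ω / 2)) * gaussSigma L a z := by
  rw [gaussSigma, sigma_add L hω hω2, gaussSigma]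
  have : Complex.exp ((2 * a * ω + 2 * zeta L (ω / 2)) * (z + ω / 2)) * Complex.exp (a * z ^ 2)
      = Complex.exp (a * (z + ω) ^ 2) * Complex.exp (2 * zeta L (ω / 2) * (z + ω / 2)) := by
    rw [← Complex.exp_add, ← Complex.exp_add]
    ring_nf
  linear_combination (sigma L z) * this

/-- If a shifted entire function vanishes on the zeros of a shifted sigma function, it is
divisible by it. -/
lemma exists_eq_mul_gaussSigma {G : ℂ → ℂ} (hG : Differentiable ℂ G) {α : ℂ}
    (h : ∀ ω ∈ L.lattice, G (α + ω) = 0) :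
    ∃ q : ℂ → ℂ, Differentiable ℂ q ∧ ∀ z, G z = q z * gaussSigma L a (z - α) := by
  have hd := differentiable_gaussSigma L a
  refine exists_eq_mul_of_simple_zeros (g := fun z => gaussSigma L a (z - α)) hG (by fun_prop)
    (fun z hz => ?_) fun z hz => ?_
  · rw [deriv_comp_sub_const]
    exact deriv_gaussSigma_ne_zero L a ((gaussSigma_eq_zero_iff L a).mp hz)
  · simpa using h _ ((gaussSigma_eq_zero_iff L a).mp hz)

end gaussSigma

lemma sigmaStar_eq (L : PeriodPair) :
    sigmaStar L = gaussSigma L (1 - quasiPeriod₁ L / (2 * L.ω₁)) := rfl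

/-- The hypotheses on the periods: `ω₁` is real and positive, `Im ω₂ > 0`, and the area of the
torus is `π / 2`. -/
structure IsNormalized (L : PeriodPair) : Prop where
  im_eq_zero : L.ω₁.im = 0
  re_pos : 0 < L.ω₁.re
  im_pos : 0 < L.ω₂.im
  area : L.ω₁.re * L.ω₂.im = Real.pi / 2

lemma IsNormalized.ω₁_eq (hL : IsNormalized L) : L.ω₁ = (L.ω₁.re : ℂ) :=
  Complex.ext (by simp) (by simp [hL.im_eq_zero])

lemma IsNormalized.ω₁_ne_zero (hL : IsNormalized L) : L.ω₁ ≠ 0 := by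
  rw [hL.ω₁_eq]; exact_mod_cast hL.re_pos.ne'

lemma IsNormalized.conj_ω₁ (hL : IsNormalized L) : conj L.ω₁ = L.ω₁ :=
  Complex.conj_eq_iff_im.mpr hL.im_eq_zero

lemma conj_eq_sub (z : ℂ) : conj z = z - 2 * z.im * Complex.I := by
  apply Complex.ext <;> simp; ring

lemma IsNormalized.pi_eq (hL : IsNormalized L) : (Real.pi : ℂ) = 2 * (L.ω₁ * L.ω₂.im) := by
  have h := hL.area
  rw [hL.ω₁_eq]
  norm_cast
  linarith

/-- The constant `b` is chosen so that `2bω₁ + λ₁ = 2ω₁`. -/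
lemma sigmaStar_add_ω₁ (hL : IsNormalized L) (z : ℂ) :
    sigmaStar L (z + L.ω₁) = -Complex.exp (2 * conj L.ω₁ * (z + L.ω₁ / 2)) * sigmaStar L z := by
  rw [sigmaStar_eq, gaussSigma_add L _ L.ω₁_mem_lattice L.ω₁_div_two_notMem_lattice, hL.conj_ω₁]
  congr 4
  have := hL.ω₁_ne_zero
  rw [quasiPeriod₁]
  field_simp
  ring

/-- The Legendre relation, in the form of the quasi-period of `σ_*` along `ω₂`. -/
lemma legendre (hL : IsNormalized L) :
    2 * (1 - quasiPeriod₁ L / (2 * L.ω₁)) * L.ω₂ + 2 * zeta L (L.ω₂ / 2) = 2 * conj L.ω₂ := by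
  set b := 1 - quasiPeriod₁ L / (2 * L.ω₁) with hb
  set μ := 2 * b * L.ω₂ + 2 * zeta L (L.ω₂ / 2) with hμ
  have hs₁ : ∀ z, gaussSigma L b (z + L.ω₁) =
      -Complex.exp (2 * L.ω₁ * (z + L.ω₁ / 2)) * gaussSigma L b z := fun z => by
    have := sigmaStar_add_ω₁ hL z
    rwa [hL.conj_ω₁] at this
  have hs₂ : ∀ z, gaussSigma L b (z + L.ω₂) =
      -Complex.exp (μ * (z + L.ω₂ / 2)) * gaussSigma L b z :=
    gaussSigma_add L b L.ω₂_mem_lattice L.ω₂_div_two_notMem_lattice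
  have hne : gaussSigma L b (L.ω₁ / 2) ≠ 0 :=
    (gaussSigma_eq_zero_iff L b).not.mpr L.ω₁_div_two_notMem_lattice
  have hω₁ := hL.ω₁_ne_zero
  -- Translating by `ω₁` and `ω₂` in either order gives the same value.
  have hcomm : Complex.exp (2 * L.ω₁ * L.ω₂) = Complex.exp (μ * L.ω₁) := by
    have e1 := hs₁ (L.ω₁ / 2 + L.ω₂)
    rw [add_right_comm, hs₂, hs₁, hs₂] at e1
    have e2 : Complex.exp (μ * (L.ω₁ / 2 + L.ω₁ + L.ω₂ / 2)) = Complex.exp (μ * L.ω₁) *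
        Complex.exp (μ * (L.ω₁ / 2 + L.ω₂ / 2)) := by
      rw [← Complex.exp_add]; ring_nf
    have e3 : Complex.exp (2 * L.ω₁ * (L.ω₁ / 2 + L.ω₂ + L.ω₁ / 2)) =
        Complex.exp (2 * L.ω₁ * L.ω₂) * Complex.exp (2 * L.ω₁ * (L.ω₁ / 2 + L.ω₁ / 2)) := by
      rw [← Complex.exp_add]; ring_nf
    rw [e2, e3] at e1
    refine mul_right_cancel₀ (mul_ne_zero (mul_ne_zero
      (Complex.exp_ne_zero (2 * L.ω₁ * (L.ω₁ / 2 + L.ω₁ / 2)))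
      (Complex.exp_ne_zero (μ * (L.ω₁ / 2 + L.ω₂ / 2)))) hne) ?_
    linear_combination -e1
  obtain ⟨d, hd⟩ := Complex.exp_eq_exp_iff_exists_int.mp hcomm
  have hμd : μ = 2 * d * conj L.ω₂ - 2 * (d - 1) * L.ω₂ := by
    rw [conj_eq_sub]
    rw [hL.pi_eq] at hd
    apply mul_right_cancel₀ hω₁
    linear_combination -hd
  -- The extra Gaussian `exp ((d-1)z²)` absorbs the term `-2(d-1)ω₂` of `μ` and turns the multiplier
  -- along `ω₁` into that of degree `d`.
  have hθ : IsTheta L d (gaussSigma L (b + (d - 1))) := by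
    have hshift : ∀ z, gaussSigma L (b + (d - 1)) z =
        Complex.exp ((d - 1) * z ^ 2) * gaussSigma L b z := fun z => by
      rw [gaussSigma, gaussSigma, ← mul_assoc, ← Complex.exp_add]
      ring_nf
    refine ⟨differentiable_gaussSigma L _, ?_⟩
    rintro ω (rfl | rfl)
    · refine ⟨-Complex.exp (d * L.ω₁ ^ 2), neg_ne_zero.mpr (Complex.exp_ne_zero _), fun z => ?_⟩
      rw [hshift, hs₁, hshift, hL.conj_ω₁]
      have : Complex.exp ((d - 1) * (z + L.ω₁) ^ 2) * Complex.exp (2 * L.ω₁ * (z + L.ω₁ / 2)) =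
          Complex.exp (d * L.ω₁ ^ 2) * Complex.exp (2 * d * L.ω₁ * z) *
            Complex.exp ((d - 1) * z ^ 2) := by
        rw [← Complex.exp_add, ← Complex.exp_add, ← Complex.exp_add]
        ring_nf
      linear_combination (-gaussSigma L b z) * this
    · refine ⟨-Complex.exp (d * L.ω₂ * conj L.ω₂), neg_ne_zero.mpr (Complex.exp_ne_zero _),
        fun z => ?_⟩
      rw [hshift, hs₂, hshift, hμd]
      have : Complex.exp ((d - 1) * (z + L.ω₂) ^ 2) *
          Complex.exp ((2 * d * conj L.ω₂ - 2 * (d - 1) * L.ω₂) * (z + L.ω₂ / 2)) =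
          Complex.exp (d * L.ω₂ * conj L.ω₂) * Complex.exp (2 * d * conj L.ω₂ * z) *
            Complex.exp ((d - 1) * z ^ 2) := by
        rw [← Complex.exp_add, ← Complex.exp_add, ← Complex.exp_add]
        ring_nf
      linear_combination (-gaussSigma L b z) * this
  have hne' : gaussSigma L (b + (d - 1)) (L.ω₁ / 2) ≠ 0 :=
    (gaussSigma_eq_zero_iff L _).not.mpr L.ω₁_div_two_notMem_lattice
  have hd0 : 0 ≤ d := hθ.nonneg ⟨_, hne'⟩ hL.im_eq_zero hL.re_pos hL.im_pos
  -- In degree zero the function would be a constant times an exponential, yet it vanishes at 0 and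
  -- not at `ω₁/2`.
  have hd1 : d ≠ 0 := by
    intro h0
    obtain ⟨K, β, hK, -⟩ :=
      hθ.exists_eq_const_mul_exp h0.le hL.im_eq_zero hL.re_pos hL.im_pos
    have hK0 := hK 0
    rw [(gaussSigma_eq_zero_iff L _).mpr (zero_mem _)] at hK0
    have : K = 0 := by simpa using hK0.symm
    exact hne' (by rw [hK, this, zero_mul])
  -- `G` has a zero, so it is divisible by a translate of the sigma multiple; the quotient is
  -- nonzero of degree `1 - d`, hence `d ≤ 1`.
  obtain ⟨G, hG, z₁, hz₁⟩ := exists_isTheta_one hL.im_eq_zero hL.re_pos hL.im_pos hL.area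
  obtain ⟨α, hα⟩ := hG.exists_zero one_ne_zero hL.im_eq_zero hL.re_pos hL.im_pos
  obtain ⟨q, hq, hGq⟩ := exists_eq_mul_gaussSigma L (b + (d - 1)) hG.differentiable
    fun ω hω => hG.apply_add_eq_zero hω hα
  have hqθ := hG.of_mul (hθ.comp_sub α) hq hGq ⟨α + L.ω₁ / 2, by simpa using hne'⟩
  have := hqθ.nonneg ⟨z₁, left_ne_zero_of_mul (hGq z₁ ▸ hz₁)⟩
    hL.im_eq_zero hL.re_pos hL.im_pos
  obtain rfl : d = 1 := by omega
  rw [hμd]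
  push_cast
  ring

lemma sigmaStar_add (hL : IsNormalized L) {ω : ℂ} (hω : ω ∈ ({L.ω₁, L.ω₂} : Set ℂ)) (z : ℂ) :
    sigmaStar L (z + ω) = -Complex.exp (2 * conj ω * (z + ω / 2)) * sigmaStar L z := by
  rcases hω with rfl | rfl
  · exact sigmaStar_add_ω₁ hL z
  · rw [sigmaStar_eq, gaussSigma_add L _ L.ω₂_mem_lattice L.ω₂_div_two_notMem_lattice, legendre hL]

/-! ### Theta spaces over a parameter `γ` -/

/-- The automorphy factor of entire theta functions of degree `N` over `γ`. -/
def factor (N : ℕ) (γ ω z : ℂ) : ℂ :=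
  (-1) ^ N * Complex.exp (2 * N * conj ω * z + N * (ω * conj ω)
    - 4 * Complex.I * ((conj ω * γ).im : ℂ))

lemma factor_ne_zero (N : ℕ) (γ ω z : ℂ) : factor N γ ω z ≠ 0 :=
  mul_ne_zero (pow_ne_zero _ (by norm_num)) (Complex.exp_ne_zero _)

lemma differentiable_factor (N : ℕ) (γ ω : ℂ) : Differentiable ℂ (factor N γ ω) := by
  unfold factor
  fun_prop

lemma factor_mul_factor (M N : ℕ) (γ γ' ω z : ℂ) :
    factor M γ ω z * factor N γ' ω z = factor (M + N) (γ + γ') ω z := by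
  simp only [factor]
  rw [mul_mul_mul_comm, ← pow_add, ← Complex.exp_add, mul_add (conj ω), Complex.add_im]
  push_cast
  ring_nf

lemma im_conj_mul (ω γ : ℂ) : (((conj ω * γ).im : ℝ) : ℂ) * (2 * Complex.I)
    = conj ω * γ - ω * conj γ := by
  have := Complex.sub_conj (conj ω * γ)
  rw [map_mul, Complex.conj_conj] at this
  rw [this]; push_cast; ring

/-- Since the area is `π/2`, `Im (conj ω * l)` is an integer multiple of `π/2`. Hence automorphy
factors depend on `γ` only modulo `Λ`. -/
lemma exp_im_conj_mul_eq_one (hL : IsNormalized L) {ω : ℂ} (hω : ω ∈ ({L.ω₁, L.ω₂} : Set ℂ))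
    {l : ℂ} (hl : l ∈ L.lattice) : Complex.exp (4 * Complex.I * ((conj ω * l).im : ℂ)) = 1 := by
  obtain ⟨m, n, rfl⟩ := PeriodPair.mem_lattice.mp hl
  have h1 := hL.im_eq_zero
  have h2 := hL.area
  rcases hω with rfl | rfl
  · refine Complex.exp_eq_one_iff.mpr ⟨n, ?_⟩
    have : (conj L.ω₁ * (m * L.ω₁ + n * L.ω₂)).im = n * (Real.pi / 2) := by
      simp [h1]; linear_combination (n : ℝ) * h2
    rw [this]; push_cast; ring
  · refine Complex.exp_eq_one_iff.mpr ⟨-m, ?_⟩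
    have : (conj L.ω₂ * (m * L.ω₁ + n * L.ω₂)).im = -m * (Real.pi / 2) := by
      simp [h1]; linear_combination (-m : ℝ) * h2
    rw [this]; push_cast; ring

lemma factor_congr (hL : IsNormalized L) {N : ℕ} {γ γ' ω : ℂ} (hω : ω ∈ ({L.ω₁, L.ω₂} : Set ℂ))
    (h : γ - γ' ∈ L.lattice) : factor N γ ω = factor N γ' ω := by
  ext z
  have h1 := exp_im_conj_mul_eq_one hL hω h
  have h3 : ((conj ω * γ).im : ℂ) = (conj ω * γ').im + (conj ω * (γ - γ')).im := by
    rw [← Complex.ofReal_add, ← Complex.add_im]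
    ring_nf
  rw [factor, factor, h3, mul_add, ← sub_sub, Complex.exp_sub, h1, div_one]

/-- The lattice is self-dual for the form `(2/π) Im (conj ω * γ)`: the two integers obtained are, up
to sign, the coordinates of `γ`. -/
lemma mem_lattice_of_exp_eq_one (hL : IsNormalized L) {γ : ℂ}
    (h : ∀ ω ∈ ({L.ω₁, L.ω₂} : Set ℂ), Complex.exp (4 * Complex.I * ((conj ω * γ).im : ℂ)) = 1) :
    γ ∈ L.lattice := by
  have key : ∀ ω ∈ ({L.ω₁, L.ω₂} : Set ℂ), ∃ n : ℤ, (conj ω * γ).im = n * (Real.pi / 2) := by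
    intro ω hω
    obtain ⟨n, hn⟩ := Complex.exp_eq_one_iff.mp (h ω hω)
    refine ⟨n, ?_⟩
    have : (4 * ((conj ω * γ).im : ℂ)) = n * (2 * Real.pi) := by
      apply mul_right_cancel₀ Complex.I_ne_zero
      linear_combination hn
    have : 4 * (conj ω * γ).im = n * (2 * Real.pi) := by exact_mod_cast this
    linarith
  obtain ⟨n, hn⟩ := key L.ω₁ (by simp)
  obtain ⟨m, hm⟩ := key L.ω₂ (by simp)
  have h1 := hL.im_eq_zero
  have hr := hL.re_pos
  have hi := hL.im_pos
  rw [← hL.area] at hn hm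
  simp only [Complex.mul_im, Complex.conj_re, Complex.conj_im, h1] at hn hm
  have him : γ.im = n * L.ω₂.im := by
    apply mul_left_cancel₀ hr.ne'
    linear_combination hn
  have hre : γ.re = -m * L.ω₁.re + n * L.ω₂.re := by
    apply mul_left_cancel₀ hi.ne'
    rw [him] at hm
    linear_combination -hm
  refine PeriodPair.mem_lattice.mpr ⟨-m, n, ?_⟩
  apply Complex.ext
  · simp [hre]
  · simp [him, h1]

/-- Entire theta functions of degree `N` over `γ`. -/
def thetaSpace (L : PeriodPair) (N : ℕ) (γ : ℂ) : Submodule ℂ (ℂ → ℂ) where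
  carrier := {G | Differentiable ℂ G ∧
    ∀ ω ∈ ({L.ω₁, L.ω₂} : Set ℂ), ∀ z, G (z + ω) = factor N γ ω z * G z}
  zero_mem' := ⟨differentiable_const 0, by simp⟩
  add_mem' := fun hF hG => ⟨hF.1.add hG.1, fun ω hω z => by
    simp only [Pi.add_apply, hF.2 ω hω, hG.2 ω hω, mul_add]⟩
  smul_mem' := fun c F hF => ⟨hF.1.const_smul c, fun ω hω z => by
    simp only [Pi.smul_apply, hF.2 ω hω, smul_eq_mul]; ring⟩

lemma mem_thetaSpace {N : ℕ} {γ : ℂ} {G : ℂ → ℂ} : G ∈ thetaSpace L N γ ↔ Differentiable ℂ G ∧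
    ∀ ω ∈ ({L.ω₁, L.ω₂} : Set ℂ), ∀ z, G (z + ω) = factor N γ ω z * G z := Iff.rfl

lemma isTheta_of_mem_thetaSpace {N : ℕ} {γ : ℂ} {G : ℂ → ℂ} (hG : G ∈ thetaSpace L N γ) :
    IsTheta L N G := by
  refine ⟨hG.1, fun ω hω => ⟨factor N γ ω 0, factor_ne_zero _ _ _ _, fun z => ?_⟩⟩
  rw [hG.2 ω hω, factor, factor, mul_assoc ((-1) ^ N) (Complex.exp _) (Complex.exp _),
    ← Complex.exp_add]
  push_cast
  ring_nf

lemma thetaSpace_congr (hL : IsNormalized L) {N : ℕ} {γ γ' : ℂ} (h : γ - γ' ∈ L.lattice) :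
    thetaSpace L N γ = thetaSpace L N γ' := by
  ext G
  rw [mem_thetaSpace, mem_thetaSpace]
  refine and_congr_right fun _ => forall₂_congr fun ω hω => ?_
  rw [factor_congr hL hω h]

lemma mul_mem_thetaSpace {M N : ℕ} {γ γ' : ℂ} {F G : ℂ → ℂ} (hF : F ∈ thetaSpace L M γ)
    (hG : G ∈ thetaSpace L N γ') : F * G ∈ thetaSpace L (M + N) (γ + γ') := by
  refine ⟨hF.1.mul hG.1, fun ω hω z => ?_⟩
  rw [Pi.mul_apply, hF.2 ω hω, hG.2 ω hω, ← factor_mul_factor, Pi.mul_apply]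
  ring

lemma const_mem_thetaSpace_zero (c : ℂ) : (fun _ => c) ∈ thetaSpace L 0 0 := by
  refine ⟨differentiable_const c, fun ω _ z => ?_⟩
  simp [factor]

/-! ### Factorization into theta functions of degree one -/

/-- The holomorphic part of the monic pseudopolynomial with root `α`. -/
def monicTheta (L : PeriodPair) (α z : ℂ) : ℂ :=
  Complex.exp (2 * conj α * z - α * conj α) * sigmaStar L (z - α)

lemma differentiable_monicTheta (α : ℂ) : Differentiable ℂ (monicTheta L α) := by
  have : Differentiable ℂ (sigmaStar L) := differentiable_gaussSigma L _
  unfold monicTheta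
  fun_prop

lemma monicTheta_eq_zero_iff {α z : ℂ} : monicTheta L α z = 0 ↔ z - α ∈ L.lattice := by
  rw [monicTheta, sigmaStar_eq, mul_eq_zero, gaussSigma_eq_zero_iff]
  simp [Complex.exp_ne_zero]

lemma exists_monicTheta_ne_zero (α : ℂ) : ∃ z, monicTheta L α z ≠ 0 :=
  ⟨α + L.ω₁ / 2, by simpa [monicTheta_eq_zero_iff] using L.ω₁_div_two_notMem_lattice⟩

/-- The shift in `σ_*` contributes `-2 conj ω * α` to the exponent and the prefactor contributes `2
conj α * ω`; together they are `-4i Im (conj ω * α)`. -/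
lemma monicTheta_mem (hL : IsNormalized L) (α : ℂ) : monicTheta L α ∈ thetaSpace L 1 α := by
  refine ⟨differentiable_monicTheta α, fun ω hω z => ?_⟩
  rw [monicTheta, add_sub_right_comm, sigmaStar_add hL hω, factor, monicTheta]
  have h := im_conj_mul ω α
  have : Complex.exp (2 * conj α * (z + ω) - α * conj α) *
      Complex.exp (2 * conj ω * (z - α + ω / 2)) =
      Complex.exp (2 * (1 : ℕ) * conj ω * z + (1 : ℕ) * (ω * conj ω)
        - 4 * Complex.I * ((conj ω * α).im : ℂ)) * Complex.exp (2 * conj α * z - α * conj α) := by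
    rw [← Complex.exp_add, ← Complex.exp_add]
    congr 1
    push_cast
    linear_combination 2 * h
  linear_combination (-sigmaStar L (z - α)) * this

lemma exists_eq_mul_monicTheta (hL : IsNormalized L) {N : ℕ} {γ α : ℂ} {G : ℂ → ℂ}
    (hG : G ∈ thetaSpace L (N + 1) γ) (hα : G α = 0) :
    ∃ q ∈ thetaSpace L N (γ - α), G = q * monicTheta L α := by
  obtain ⟨q₀, hq₀, h⟩ := exists_eq_mul_gaussSigma L (1 - quasiPeriod₁ L / (2 * L.ω₁)) hG.1
    fun ω hω => (isTheta_of_mem_thetaSpace hG).apply_add_eq_zero hω hα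
  have hq : ∀ z, G z = (Complex.exp (-(2 * conj α * z - α * conj α)) * q₀ z) *
      monicTheta L α z := fun z => by
    rw [h, monicTheta, Complex.exp_neg, sigmaStar_eq]
    have := Complex.exp_ne_zero (2 * conj α * z - α * conj α)
    field_simp
  refine ⟨fun z => Complex.exp (-(2 * conj α * z - α * conj α)) * q₀ z,
    ⟨by fun_prop, fun ω hω => ?_⟩, funext hq⟩
  refine quasiPeriodic_of_mul (differentiable_monicTheta (L := L) α) (by fun_prop)
    (differentiable_factor _ _ _) (factor_ne_zero 1 α ω) hq (fun z => ?_)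
    ((monicTheta_mem hL α).2 ω hω) (exists_monicTheta_ne_zero α)
  rw [factor_mul_factor, sub_add_cancel]
  exact hG.2 ω hω z

/-- The degree-zero factors are unimodular, so `G` is bounded and constant; a nonzero constant makes
them equal to 1, and self-duality places `γ` in `Λ`. -/
lemma eq_const_of_mem_thetaSpace_zero (hL : IsNormalized L) {γ : ℂ} {G : ℂ → ℂ}
    (hG : G ∈ thetaSpace L 0 γ) (h0 : G ≠ 0) : γ ∈ L.lattice ∧ G = fun _ => G 0 := by
  have hfac : ∀ ω z, factor 0 γ ω z = Complex.exp (((-4 * (conj ω * γ).im : ℝ) : ℂ) * Complex.I) :=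
    fun ω z => by
      rw [factor]; push_cast; ring_nf
  have hnorm : ∀ ω ∈ ({L.ω₁, L.ω₂} : Set ℂ), ∀ z, ‖G (z + ω)‖ = ‖G z‖ := fun ω hω z => by
    rw [hG.2 ω hω, hfac, norm_mul, Complex.norm_exp_ofReal_mul_I, one_mul]
  obtain ⟨C, hC⟩ := exists_bound_of_periodic (L := L) hG.1.continuous.norm
    (hnorm _ (by simp)) (hnorm _ (by simp))
  have hconst : ∀ z, G z = G 0 := fun z => hG.1.apply_eq_apply_of_bounded
    (isBounded_iff_forall_norm_le.mpr ⟨C, by rintro _ ⟨w, rfl⟩; exact hC w⟩) z 0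
  refine ⟨mem_lattice_of_exp_eq_one hL fun ω hω => ?_, funext hconst⟩
  have hG0 : G 0 ≠ 0 := fun h => h0 (funext fun z => by rw [hconst, h]; rfl)
  have h1 := hG.2 ω hω 0
  rw [hconst (0 + ω), hfac] at h1
  have h2 : Complex.exp (((-4 * (conj ω * γ).im : ℝ) : ℂ) * Complex.I) = 1 :=
    mul_right_cancel₀ hG0 (by rw [← h1, one_mul])
  have h3 : 4 * Complex.I * ((conj ω * γ).im : ℂ)
      = -(((-4 * (conj ω * γ).im : ℝ) : ℂ) * Complex.I) := by
    push_cast; ring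
  rw [h3, Complex.exp_neg, h2, inv_one]

/-- Factorization of theta functions. -/
lemma exists_eq_mul_prod_monicTheta (hL : IsNormalized L) {N : ℕ} : ∀ {γ : ℂ} {G : ℂ → ℂ},
    G ∈ thetaSpace L N γ → G ≠ 0 → ∃ (c : ℂ) (α : Fin N → ℂ), (∑ j, α j) - γ ∈ L.lattice ∧
      G = fun z => c * ∏ j, monicTheta L (α j) z := by
  induction N with
  | zero =>
    intro γ G hG h0
    obtain ⟨hγ, hc⟩ := eq_const_of_mem_thetaSpace_zero hL hG h0
    exact ⟨G 0, fun _ => 0, by simpa using neg_mem hγ, by simpa using hc⟩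
  | succ N ih =>
    intro γ G hG h0
    obtain ⟨a, ha⟩ := (isTheta_of_mem_thetaSpace hG).exists_zero (by positivity)
      hL.im_eq_zero hL.re_pos hL.im_pos
    obtain ⟨q, hq, rfl⟩ := exists_eq_mul_monicTheta hL hG ha
    obtain ⟨c, α, hα, rfl⟩ := ih hq (left_ne_zero_of_mul h0)
    refine ⟨c, Fin.cons a α, ?_, ?_⟩
    · rw [Fin.sum_univ_succ]
      simp only [Fin.cons_zero, Fin.cons_succ]
      convert hα using 1
      ring
    · ext z
      rw [Fin.prod_univ_succ]
      simp only [Fin.cons_zero, Fin.cons_succ, Pi.mul_apply]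
      ring

lemma prod_monicTheta_mem (hL : IsNormalized L) {N : ℕ} : ∀ α : Fin N → ℂ,
    (fun z => ∏ j, monicTheta L (α j) z) ∈ thetaSpace L N (∑ j, α j) := by
  induction N with
  | zero => intro α; simpa using const_mem_thetaSpace_zero (L := L) 1
  | succ N ih =>
    intro α
    have := mul_mem_thetaSpace (ih fun j => α j.succ) (monicTheta_mem hL (α 0))
    rw [Fin.sum_univ_succ, add_comm (α 0)]
    convert this using 1
    ext z
    rw [Fin.prod_univ_succ, Pi.mul_apply, mul_comm]

lemma mem_thetaSpace_iff (hL : IsNormalized L) {N : ℕ} (hN : 1 ≤ N) {γ : ℂ} {G : ℂ → ℂ} :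
    G ∈ thetaSpace L N γ ↔ ∃ (c : ℂ) (α : Fin N → ℂ), (∑ j, α j) - γ ∈ L.lattice ∧
      G = fun z => c * ∏ j, monicTheta L (α j) z := by
  refine ⟨fun hG => ?_, ?_⟩
  · by_cases h0 : G = 0
    -- The zero function also needs an admissible root vector, which requires `N ≥ 1` when `γ ∉ Λ`.
    · refine ⟨0, fun j => if j = ⟨0, hN⟩ then γ else 0, by simp, ?_⟩
      simp only [zero_mul]
      exact h0
    · exact exists_eq_mul_prod_monicTheta hL hG h0
  · rintro ⟨c, α, hα, rfl⟩
    rw [← thetaSpace_congr hL hα]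
    exact Submodule.smul_mem _ c (prod_monicTheta_mem hL α)

/-! ### Dimension of theta spaces -/

/-- Multiplication by a monic theta function of degree one. -/
def mulMonicTheta (hL : IsNormalized L) (N : ℕ) (γ α : ℂ) :
    thetaSpace L N (γ - α) →ₗ[ℂ] thetaSpace L (N + 1) γ where
  toFun q := ⟨q.1 * monicTheta L α, by
    simpa using mul_mem_thetaSpace q.2 (monicTheta_mem hL α)⟩
  map_add' p q := Subtype.ext (add_mul _ _ _)
  map_smul' c q := Subtype.ext (smul_mul_assoc c _ _)

lemma mulMonicTheta_injective (hL : IsNormalized L) (N : ℕ) (γ α : ℂ) :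
    Function.Injective (mulMonicTheta hL N γ α) := by
  rw [← LinearMap.ker_eq_bot, LinearMap.ker_eq_bot']
  rintro ⟨q, hq⟩ h
  have h' : q * monicTheta L α = 0 := congrArg Subtype.val h
  obtain ⟨z₀, hz₀⟩ := exists_monicTheta_ne_zero (L := L) α
  refine Subtype.ext (AnalyticOnNhd.eq_of_eventuallyEq (𝕜 := ℂ) (z₀ := z₀)
    (hq.1.differentiableOn.analyticOnNhd isOpen_univ)
    ((differentiable_const 0).differentiableOn.analyticOnNhd isOpen_univ) ?_)
  filter_upwards [(differentiable_monicTheta α z₀).continuousAt.eventually_ne hz₀] with z hz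
  exact (mul_eq_zero.mp (congrFun h' z)).resolve_right hz

/-- Evaluation at a point. -/
def evalAt (L : PeriodPair) (N : ℕ) (γ α : ℂ) : thetaSpace L N γ →ₗ[ℂ] ℂ :=
  (LinearMap.proj α).comp (thetaSpace L N γ).subtype

lemma ker_evalAt (hL : IsNormalized L) (N : ℕ) (γ α : ℂ) :
    LinearMap.ker (evalAt L (N + 1) γ α) = LinearMap.range (mulMonicTheta hL N γ α) := by
  ext G
  refine ⟨fun h => ?_, ?_⟩
  · obtain ⟨q, hq, h⟩ := exists_eq_mul_monicTheta hL G.2 (α := α) h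
    exact ⟨⟨q, hq⟩, Subtype.ext h.symm⟩
  · rintro ⟨q, rfl⟩
    have : monicTheta L α α = 0 := monicTheta_eq_zero_iff.mpr (by simp)
    change q.1 α * monicTheta L α α = 0
    rw [this, mul_zero]

/-- Rank-nullity for evaluation at `α`, which is onto; its kernel consists of the multiples of
`monicTheta L α`. -/
lemma rank_thetaSpace_succ (hL : IsNormalized L) (N : ℕ) (γ α : ℂ)
    (h : ∃ G ∈ thetaSpace L (N + 1) γ, G α ≠ 0) :
    Module.rank ℂ (thetaSpace L (N + 1) γ) = Module.rank ℂ (thetaSpace L N (γ - α)) + 1 := by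
  obtain ⟨G, hG, hne⟩ := h
  have hsurj : LinearMap.range (evalAt L (N + 1) γ α) = ⊤ := by
    rw [LinearMap.range_eq_top]
    intro c
    refine ⟨(c / G α) • ⟨G, hG⟩, ?_⟩
    change c / G α * G α = c
    rw [div_mul_cancel₀ _ hne]
  rw [← LinearMap.rank_range_add_rank_ker (evalAt L (N + 1) γ α), hsurj, rank_top, Module.rank_self,
    ker_evalAt hL, add_comm, (LinearEquiv.ofInjective _ (mulMonicTheta_injective hL N γ α)).rank_eq]

/-- The side condition excludes degree zero over `Λ`, where the constants give rank one; it lets the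
induction start from the zero space. -/
lemma rank_thetaSpace (hL : IsNormalized L) (N : ℕ) : ∀ γ : ℂ, (N = 0 → γ ∉ L.lattice) →
    Module.rank ℂ (thetaSpace L N γ) = N := by
  induction N with
  | zero =>
    intro γ hγ
    have : thetaSpace L 0 γ = ⊥ := by
      rw [eq_bot_iff]
      intro G hG
      by_contra h0
      exact hγ rfl (eq_const_of_mem_thetaSpace_zero hL hG h0).1
    rw [this, rank_bot, Nat.cast_zero]
  | succ N ih =>
    intro γ _
    set β := γ / ((N : ℂ) + 1) with hβ
    have hN : (N : ℂ) + 1 ≠ 0 := by exact_mod_cast N.succ_ne_zero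
    have hsum : ∑ _j : Fin (N + 1), β = γ := by
      rw [Finset.sum_const, Finset.card_univ, Fintype.card_fin, nsmul_eq_mul, hβ]
      push_cast
      exact mul_div_cancel₀ γ hN
    -- The product with all roots equal to `β` lies over `γ` and is nonzero at `β + ω₁/2`. For `N =
    -- 0` the new parameter is `-ω₁/2`, which lies outside `Λ`.
    rw [rank_thetaSpace_succ hL N γ (β + L.ω₁ / 2), ih]
    · push_cast; rfl
    · rintro rfl
      have : γ - (β + L.ω₁ / 2) = -(L.ω₁ / 2) := by simp [hβ]
      rw [this]
      exact fun h => L.ω₁_div_two_notMem_lattice (by simpa using neg_mem h)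
    · have := prod_monicTheta_mem hL fun _ : Fin (N + 1) => β
      rw [hsum] at this
      refine ⟨_, this, Finset.prod_ne_zero_iff.mpr fun j _ => ?_⟩
      simpa [monicTheta_eq_zero_iff] using L.ω₁_div_two_notMem_lattice

/-! ### Passage between pseudopolynomials and theta functions -/

/-- The Gaussian weight `exp (c |z|²)`. -/
def weight (c z : ℂ) : ℂ := Complex.exp (c * (z * conj z))

lemma weight_mul_weight_neg (c z : ℂ) : weight c z * weight (-c) z = 1 := by
  rw [weight, weight, ← Complex.exp_add]; simp

lemma contDiff_weight (c : ℂ) : ContDiff ℝ 1 (weight c) := by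
  have : ContDiff ℝ 1 (fun z : ℂ => conj z) := Complex.conjCLE.contDiff
  unfold weight
  fun_prop

lemma dbar_weight (c z : ℂ) : dbar (weight c) z = c * z * weight c z := by
  have h1 : HasFDerivAt (fun z : ℂ => conj z) (Complex.conjCLE : ℂ →L[ℝ] ℂ) z :=
    Complex.conjCLE.hasFDerivAt
  have h2 := ((hasFDerivAt_id (𝕜 := ℝ) z).mul h1).const_mul c
  have h3 : HasFDerivAt (weight c) _ z := h2.cexp
  rw [dbar, h3.fderiv, weight]
  simp
  ring_nf
  simp
  ring

lemma dbar_mul {F G : ℂ → ℂ} {z : ℂ} (hF : DifferentiableAt ℝ F z) (hG : DifferentiableAt ℝ G z) :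
    dbar (fun z => F z * G z) z = dbar F z * G z + F z * dbar G z := by
  have h : HasFDerivAt (fun z => F z * G z) _ z := hF.hasFDerivAt.mul hG.hasFDerivAt
  simp only [dbar, h.fderiv]
  simp
  ring

lemma dbar_eq_zero_iff {F : ℂ → ℂ} {z : ℂ} (hF : DifferentiableAt ℝ F z) :
    dbar F z = 0 ↔ DifferentiableAt ℂ F z := by
  rw [differentiableAt_complex_iff_differentiableAt_real, dbar, smul_eq_mul]
  simp only [hF, true_and]
  have hI := Complex.I_mul_I
  constructor
  · intro h
    linear_combination (-2 * Complex.I) * h + (fderiv ℝ F z Complex.I) * hI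
  · intro h
    rw [h]
    linear_combination (fderiv ℝ F z 1 / 2) * hI

lemma dbar_mul_weight {F : ℂ → ℂ} {z : ℂ} (hF : DifferentiableAt ℝ F z) (c : ℂ) :
    dbar (fun z => F z * weight c z) z = (dbar F z + c * z * F z) * weight c z := by
  rw [dbar_mul hF ((contDiff_weight c).differentiable one_ne_zero z), dbar_weight]
  ring

/-- The increment of `N|z|²` supplies `2N Re (conj ω * z)`, the real part missing from the
unimodular multiplier, and the term `N|ω|²`. -/
lemma weight_add (N : ℕ) (γ ω z : ℂ) :
    (-1) ^ N * Complex.exp (2 * Complex.I * ((conj ω * ((N : ℂ) * z - 2 * γ)).im : ℂ)) *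
      weight N (z + ω) = factor N γ ω z * weight N z := by
  have h1 := im_conj_mul ω (N * z - 2 * γ)
  have h2 := im_conj_mul ω γ
  rw [weight, factor, weight, mul_assoc ((-1) ^ N) (Complex.exp _) (Complex.exp _),
    mul_assoc ((-1) ^ N) (Complex.exp _) (Complex.exp _), ← Complex.exp_add, ← Complex.exp_add]
  congr 2
  simp only [map_sub, map_mul, map_add, Complex.conj_natCast, Complex.conj_ofNat] at h1 ⊢
  linear_combination h1 + 2 * h2

/-- The analytic characterization, transported to theta functions. -/
lemma mul_weight_mem_thetaSpace_iff {N : ℕ} {γ : ℂ} {F : ℂ → ℂ} :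
    (fun z => F z * weight N z) ∈ thetaSpace L N γ ↔
      ContDiff ℝ 1 F ∧ (∀ z : ℂ, dbar F z + (N : ℂ) * z * F z = 0) ∧
      (∀ ω ∈ ({L.ω₁, L.ω₂} : Set ℂ), ∀ z : ℂ,
        F (z + ω) = (-1) ^ N *
          Complex.exp (2 * Complex.I * ((conj ω * ((N : ℂ) * z - 2 * γ)).im : ℂ)) * F z) := by
  have hw : ∀ c z, weight c z ≠ 0 := fun c z => Complex.exp_ne_zero _
  have hper : (∀ ω ∈ ({L.ω₁, L.ω₂} : Set ℂ), ∀ z : ℂ, F (z + ω) * weight N (z + ω) =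
      factor N γ ω z * (F z * weight N z)) ↔ (∀ ω ∈ ({L.ω₁, L.ω₂} : Set ℂ), ∀ z : ℂ,
        F (z + ω) = (-1) ^ N *
          Complex.exp (2 * Complex.I * ((conj ω * ((N : ℂ) * z - 2 * γ)).im : ℂ)) * F z) := by
    refine forall₃_congr fun ω _ z => ?_
    have h := weight_add N γ ω z
    rw [show factor N γ ω z * (F z * weight N z) = factor N γ ω z * weight N z * F z by ring, ← h,
      mul_right_comm]
    exact mul_left_inj' (hw _ _)
  rw [mem_thetaSpace, hper, ← and_assoc]
  refine and_congr_left fun _ => ⟨fun h => ?_, fun h z => ?_⟩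
  · have hF : F = fun z => F z * weight N z * weight (-N) z := by
      ext z
      rw [mul_assoc, weight_mul_weight_neg, mul_one]
    have hc : ContDiff ℝ 1 F := by
      rw [hF]
      exact (h.contDiff (n := 1)).restrict_scalars ℝ |>.mul (contDiff_weight _)
    refine ⟨hc, fun z => ?_⟩
    have hz := hc.differentiable one_ne_zero z
    have := (dbar_eq_zero_iff ((h z).restrictScalars ℝ)).mpr (h z)
    rw [dbar_mul_weight hz] at this
    exact (mul_eq_zero.mp this).resolve_right (hw _ _)
  · have hz := h.1.differentiable one_ne_zero z
    rw [← dbar_eq_zero_iff (hz.fun_mul ((contDiff_weight _).differentiable one_ne_zero z)),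
      dbar_mul_weight hz, h.2 z, zero_mul]

/-- Completing `2i Im (conj α * z) - |z-α|²` gives `2 conj α * z - |α|² - |z|²`, holomorphic apart
from the last term. -/
lemma monicOne_eq (α z : ℂ) : monicOne L α z = monicTheta L α z * weight (-1) z := by
  have h : (((‖z - α‖ ^ 2 : ℝ)) : ℂ) = (z - α) * conj (z - α) := by
    rw [Complex.mul_conj, Complex.normSq_eq_norm_sq]
  rw [monicOne, monicTheta, weight, h, ← Complex.exp_add, mul_right_comm (Complex.exp _),
    ← Complex.exp_add]
  congr 2
  have := im_conj_mul α z
  rw [map_sub]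
  linear_combination this

lemma monic_eq {N : ℕ} (α : Fin N → ℂ) (z : ℂ) :
    monic L α z = (∏ j, monicTheta L (α j) z) * weight (-N) z := by
  simp only [monic, monicOne_eq]
  rw [Finset.prod_mul_distrib, Finset.prod_const, Finset.card_univ, Fintype.card_fin, weight,
    weight, ← Complex.exp_nat_mul]
  ring_nf

lemma mem_fiber_iff (hL : IsNormalized L) {N : ℕ} (hN : 1 ≤ N) {γ : ℂ} {F : ℂ → ℂ} :
    F ∈ fiber L N γ ↔ (fun z => F z * weight N z) ∈ thetaSpace L N γ := by
  rw [mem_thetaSpace_iff hL hN]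
  refine exists₂_congr fun c α => and_congr_right fun _ => ?_
  rw [funext_iff, funext_iff]
  refine forall_congr' fun z => ?_
  have h := weight_mul_weight_neg N z
  rw [monic_eq]
  constructor
  · intro h'
    rw [h']
    linear_combination (c * ∏ j, monicTheta L (α j) z) * h
  · intro h'
    linear_combination weight (-N) z * h' - F z * h

/-- Multiplication by a Gaussian weight. -/
def mulWeight (c : ℂ) : (ℂ → ℂ) ≃ₗ[ℂ] (ℂ → ℂ) where
  toFun F z := F z * weight c z
  invFun F z := F z * weight (-c) z
  left_inv F := funext fun z => by
    simp only
    rw [mul_assoc, weight_mul_weight_neg, mul_one]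
  right_inv F := funext fun z => by
    simp only
    rw [mul_assoc, mul_comm (weight (-c) z), weight_mul_weight_neg, mul_one]
  map_add' F G := funext fun z => add_mul _ _ _
  map_smul' a F := funext fun z => mul_assoc _ _ _

end TorusPseudopoly

end

theorem proposition5p2 (L : PeriodPair)
    (hω₁_real : L.ω₁.im = 0) (hω₁_pos : 0 < L.ω₁.re) (hω₂ : 0 < L.ω₂.im)
    (harea : L.ω₁.re * L.ω₂.im = Real.pi / 2)
    (N : ℕ) (hN : 1 ≤ N) (γ : ℂ) :
    (∀ F : ℂ → ℂ, F ∈ TorusPseudopoly.fiber L N γ ↔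
      ContDiff ℝ 1 F ∧
      (∀ z : ℂ, TorusPseudopoly.dbar F z + (N : ℂ) * z * F z = 0) ∧
      (∀ ω ∈ ({L.ω₁, L.ω₂} : Set ℂ), ∀ z : ℂ,
        F (z + ω) = (-1) ^ N *
          Complex.exp (2 * Complex.I * ((conj ω * ((N : ℂ) * z - 2 * γ)).im : ℂ)) * F z)) ∧
    (∃ V : Submodule ℂ (ℂ → ℂ),
      (V : Set (ℂ → ℂ)) = TorusPseudopoly.fiber L N γ ∧ Module.rank ℂ V = (N : Cardinal)) := by
  have hL : TorusPseudopoly.IsNormalized L := ⟨hω₁_real, hω₁_pos, hω₂, harea⟩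
  refine ⟨fun F => (TorusPseudopoly.mem_fiber_iff hL hN).trans
    TorusPseudopoly.mul_weight_mem_thetaSpace_iff,
    (TorusPseudopoly.thetaSpace L N γ).comap (TorusPseudopoly.mulWeight N).toLinearMap, ?_, ?_⟩
  · ext F
    exact (TorusPseudopoly.mem_fiber_iff hL hN).symm
  · rw [← TorusPseudopoly.rank_thetaSpace hL N γ (by omega)]
    exact ((TorusPseudopoly.mulWeight N).ofSubmodule' _).rank_eq
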